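/- Let $d\ge 2$. A convex body in $\mathbb R^d$ is a compact convex subset of $\mathbb R^d$ with non-empty interior. For a convex body $K\subset\mathbb R^d$ let $\Delta(K)=\mathbb E|X_1-X_2|$ be the mean Euclidean distance of two independent random points $X_1,X_2$ uniformly distributed in $K$, and let $$V_1(K)=\sqrt\pi\,\frac{\Gamma\left(\frac{d+1}{2}\right)}{\Gamma\left(\frac d2\right)}\int_{\mathbb S^{d-1}}|P_{u}K|\,\mu(du)$$ be its first intrinsic volume, where $|P_uK|$ is the length of the orthogonal projection of $K$ onto the line spanned by $u$ and $\mu$ is the rotation invariant probability measure on the unit sphere $\mathbb S^{d-1}$. Then every convex body $K\subset\mathbb R^d$ satisfies $$\frac{3d+1}{2(d+1)(2d+1)}<\frac{\Delta(K)}{V_1(K)}<\frac13 .$$ Moreover, both bounds are sharp: with $e_1,\dots,e_d$ the standard basis of $\mathbb R^d$, the sets $$K_\delta=\mathrm{conv}(e_1,-e_1,\delta e_2,\dots,\delta e_d),\qquad K'_\delta=[-1,1]\times[0,\delta]^{d-1}\qquad(\delta>0)$$ are convex bodies, and $$\lim_{\delta\downarrow 0}\frac{\Delta(K_\delta)}{V_1(K_\delta)}=\frac{3d+1}{2(d+1)(2d+1)},\qquad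 \lim_{\delta\downarrow 0}\frac{\Delta(K'_\delta)}{V_1(K'_\delta)}=\frac13 .$$ -/

import Mathlib

open MeasureTheory ProbabilityTheory Filter Topology

noncomputable section

namespace MeanDistance

/-- A convex body in `ℝ^d`: a compact convex set with non-empty interior. -/
structure IsConvexBody {d : ℕ} (K : Set (EuclideanSpace ℝ (Fin d))) : Prop where
  isCompact : IsCompact K
  convex : Convex ℝ K
  nonempty_interior : (interior K).Nonempty

/-- The uniform distribution on `K`, i.e. normalized Lebesgue measure restricted to `K`. -/
def uniformLaw {d : ℕ} (K : Set (EuclideanSpace ℝ (Fin d))) :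
    Measure (EuclideanSpace ℝ (Fin d)) :=
  ProbabilityTheory.cond volume K

/-- The mean distance `Δ(K) = E |X₁ - X₂|`, where `(X₁, X₂)` has the law of two independent
random points that are uniformly distributed in `K`. -/
def meanDistance {d : ℕ} (K : Set (EuclideanSpace ℝ (Fin d))) : ℝ :=
  ∫ p : EuclideanSpace ℝ (Fin d) × EuclideanSpace ℝ (Fin d), ‖p.1 - p.2‖
    ∂((uniformLaw K).prod (uniformLaw K))

/-- The length `|P_u K|` of the orthogonal projection of `K` onto the line spanned by the unit
vector `u`; the point `⟪u, x⟫ • u` of that line is given by its signed coordinate `⟪u, x⟫`. -/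
def projLength {d : ℕ} (K : Set (EuclideanSpace ℝ (Fin d))) (u : EuclideanSpace ℝ (Fin d)) : ℝ :=
  volume.real ((fun x : EuclideanSpace ℝ (Fin d) => inner ℝ u x) '' K)

/-- The mean width `W(K)`: the average of `|P_u K|` with respect to the rotation invariant
probability measure on the unit sphere (`⨍` divides by the total mass of the surface measure). -/
def meanWidth {d : ℕ} (K : Set (EuclideanSpace ℝ (Fin d))) : ℝ :=
  ⨍ u : Metric.sphere (0 : EuclideanSpace ℝ (Fin d)) 1, projLength K u
    ∂((volume : Measure (EuclideanSpace ℝ (Fin d))).toSphere)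

/-- The first intrinsic volume `V₁(K) = √π Γ((d+1)/2) / Γ(d/2) · W(K)`. -/
def firstIntrinsicVolume {d : ℕ} (K : Set (EuclideanSpace ℝ (Fin d))) : ℝ :=
  Real.sqrt Real.pi * (Real.Gamma (((d : ℝ) + 1) / 2) / Real.Gamma ((d : ℝ) / 2)) * meanWidth K

/-- `K_δ = conv(e₁, -e₁, δ e₂, …, δ e_d)`; the coordinate with index `0` is the first one. -/
def thinSimplex (d : ℕ) (δ : ℝ) : Set (EuclideanSpace ℝ (Fin d)) :=
  convexHull ℝ
    {x | ∃ i : Fin d,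
      ((i : ℕ) = 0 ∧ (x = EuclideanSpace.single i 1 ∨ x = -EuclideanSpace.single i 1)) ∨
      ((i : ℕ) ≠ 0 ∧ x = δ • EuclideanSpace.single i 1)}

/-- `K'_δ = [-1, 1] × [0, δ]^(d-1)`; the coordinate with index `0` is the first one. -/
def thinBox (d : ℕ) (δ : ℝ) : Set (EuclideanSpace ℝ (Fin d)) :=
  {x | ∀ i : Fin d,
    ((i : ℕ) = 0 → x i ∈ Set.Icc (-1 : ℝ) 1) ∧ ((i : ℕ) ≠ 0 → x i ∈ Set.Icc (0 : ℝ) δ)}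

end MeanDistance

end

/-!
The Euclidean norm is a multiple of a spherical average: `‖x‖ = c ⨍ |⟪x, u⟫| du`, with the same
constant `c` (`widthConst`) that turns the mean width into the first intrinsic volume
(`widthConst_mul_average_abs_inner`). Hence

  `Δ(K) / V₁(K) = ∫ E|⟪u, X₁ - X₂⟫| du / ∫ |P_u K| du`,

and it suffices to compare the two integrands for every unit vector `u`. This is a one-dimensional
problem: if `⟪u, X⟫` has the distribution function `F` and the density `f` on `[a, b]`, then
`E|⟪u, X₁ - X₂⟫| = 2 ∫ F (1 - F)` and `|P_u K| = b - a` (`integral_abs_sub_eq_integral_cdf`).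
By the Brunn–Minkowski inequality, derived here from the Prékopa–Leindler inequality, `log f`,
`F ^ (1/d)` and `(1 - F) ^ (1/d)` are concave (`isProjectionLaw_fstCdf`).

* Log-concavity makes `f` a concave function of `F`, so that `1/f` is convex in `F`. Comparing
  `1/f` with its chord between the two zeros of `1/6 - F (1 - F)` gives `2 ∫ F (1 - F) ≤ (b - a)/3`
  (`integral_le_of_logConcave`). In case of equality `1 - F` decreases at least linearly to `0` at
  the endpoint `b`.
* Below the median, the concave function `F ^ (1/d)` is compared with a linear one; the other half
  is symmetric with `1 - F` in place of `F`. This gives the lower bound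
  (`lowerConst_mul_le_integral`), and equality forces `1 - F` to be the `d`-th power of a linear
  function near `b`.

Both cases of equality fail for some direction. In the direction of a diameter, `K` lies in a ball
that touches the supporting hyperplane, so caps have volume `O(h ^ ((d+1)/2))`, which is `o(h)`
(`exists_meanProj_lt`). In a direction in which a ball inside `K` touches a supporting hyperplane,
caps have volume at least of this order, which is not `O(h ^ d)` (`exists_lt_meanProj`). As the
integrands are continuous in `u`, both bounds are strict (`ratio_bounds`).

If `K` degenerates to the segment `[-e₁, e₁]`, then `V₁(K) → 2` and `Δ(K)` has the same limit as the
mean distance of the projections to the first axis (`tendsto_ratio_of_isThin`). For the boxes and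
the simplices this law does not depend on `δ`, and it is extremal in the one-dimensional problem.
-/

namespace MeanDistance

open Set
open scoped ENNReal Pointwise

/-! ### The Prékopa–Leindler inequality -/

lemma volume_affine_image_real {p : ℝ} (hp : 0 < p) (c : ℝ) (K : Set ℝ) :
    volume ((fun x : ℝ => p * x + c) '' K) = ENNReal.ofReal p * volume K := by
  have : (fun x : ℝ => p * x + c) '' K = (fun x => x + c) '' (p • K) := by
    rw [← image_smul, image_image]; rfl
  rw [this, image_add_right, measure_preimage_add_right, Measure.addHaar_smul]
  simp [abs_of_pos hp]

lemma volume_combo_le_of_isCompact {p q : ℝ} (hp : 0 < p) (hq : 0 < q) {A B C : Set ℝ}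
    (hA : IsCompact A) (hB : IsCompact B) (hA0 : A.Nonempty) (hB0 : B.Nonempty)
    (h : ∀ a ∈ A, ∀ b ∈ B, p * a + q * b ∈ C) :
    ENNReal.ofReal p * volume A + ENNReal.ofReal q * volume B ≤ volume C := by
  obtain ⟨a, haA, ha⟩ := hA.exists_isLeast hA0
  obtain ⟨b, hbB, hb⟩ := hB.exists_isGreatest hB0
  have hX := volume_affine_image_real hp (q * b) A
  have hY := volume_affine_image_real hq (p * a) B
  -- The translates `pA + qb` and `pa + qB` lie on different sides of the point `pa + qb`.
  set X := (fun x : ℝ => p * x + q * b) '' A with hXdef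
  set Y := (fun x : ℝ => q * x + p * a) '' B with hYdef
  have hYc : IsCompact Y := hB.image (by fun_prop)
  have hint : volume (X ∩ Y) = 0 := by
    refine measure_mono_null (t := {p * a + q * b}) ?_ (by simp)
    rintro _ ⟨⟨x, hx, rfl⟩, ⟨y, hy, hxy⟩⟩
    have h1 := mul_le_mul_of_nonneg_left (ha hx) hp.le
    have h2 := mul_le_mul_of_nonneg_left (hb hy) hq.le
    simp only [mem_singleton_iff] at *
    linarith
  have hsub : X ∪ Y ⊆ C := by
    rintro _ (⟨x, hx, rfl⟩ | ⟨y, hy, rfl⟩)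
    · exact h x hx b hbB
    · have := h a haA y hy
      rwa [add_comm] at this
  rw [← hX, ← hY, ← measure_union_add_inter X hYc.measurableSet, hint, add_zero]
  exact measure_mono hsub

lemma mul_measure_add_le_of_forall_isCompact {A : Set ℝ} (hA : MeasurableSet A)
    (hA0 : A.Nonempty) {p : ℝ} {c M : ℝ≥0∞}
    (h : ∀ K ⊆ A, IsCompact K → K.Nonempty → ENNReal.ofReal p * volume K + c ≤ M) :
    ENNReal.ofReal p * volume A + c ≤ M := by
  by_contra! hlt
  obtain ⟨x, hx⟩ := hA0
  rcases eq_or_ne (volume A) 0 with h0 | h0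
  · have := h {x} (by simpa) isCompact_singleton (by simp)
    simp only [Real.volume_singleton, h0] at this hlt
    exact absurd this (not_le.2 hlt)
  · have hcont : Continuous fun x : ℝ≥0∞ => ENNReal.ofReal p * x + c :=
      (ENNReal.continuous_const_mul ENNReal.ofReal_ne_top).add continuous_const
    have hnhds := (hcont.isOpen_preimage _ isOpen_Ioi).mem_nhds (show volume A ∈ _ from hlt)
    obtain ⟨r, hr, hsub⟩ := exists_Ioc_subset_of_mem_nhds hnhds ⟨0, pos_iff_ne_zero.2 h0⟩
    obtain ⟨K, hKA, hK, hrK⟩ := hA.exists_lt_isCompact hr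
    have hK0 : K.Nonempty := by
      rw [nonempty_iff_ne_empty]; rintro rfl; simp at hrK
    exact absurd (h K hKA hK hK0) (not_le.2 (hsub ⟨hrK, measure_mono hKA⟩))

/-- The Brunn–Minkowski inequality on the real line. -/
lemma volume_combo_le {p q : ℝ} (hp : 0 < p) (hq : 0 < q) {A B C : Set ℝ}
    (hA : MeasurableSet A) (hB : MeasurableSet B) (hA0 : A.Nonempty) (hB0 : B.Nonempty)
    (h : ∀ a ∈ A, ∀ b ∈ B, p * a + q * b ∈ C) :
    ENNReal.ofReal p * volume A + ENNReal.ofReal q * volume B ≤ volume C := by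
  refine mul_measure_add_le_of_forall_isCompact hA hA0 fun K hKA hK hK0 => ?_
  rw [add_comm]
  refine mul_measure_add_le_of_forall_isCompact hB hB0 fun L hLB hL hL0 => ?_
  rw [add_comm]
  exact volume_combo_le_of_isCompact hp hq hK hL hK0 hL0
    fun a ha b hb => h a (hKA ha) b (hLB hb)

/-- The Prékopa–Leindler inequality on the line for functions with supremum `1`, in its stronger
additive form. Each superlevel set of `h` contains a convex combination of those of `f`, `g`. -/
lemma lintegral_combo_le_of_sup_eq_one {p q : ℝ} (hp : 0 < p) (hq : 0 < q) (hpq : p + q = 1)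
    {f g h : ℝ → ℝ} (hf : Measurable f) (hg : Measurable g) (hh : Measurable h)
    (hf0 : ∀ x, 0 ≤ f x) (hg0 : ∀ x, 0 ≤ g x) (hh0 : ∀ x, 0 ≤ h x)
    (hf1 : ∀ x, f x ≤ 1) (hg1 : ∀ x, g x ≤ 1)
    (hfs : ∀ t < 1, ∃ x, t < f x) (hgs : ∀ t < 1, ∃ x, t < g x)
    (hfgh : ∀ x y, f x ^ p * g y ^ q ≤ h (p * x + q * y)) :
    ENNReal.ofReal p * (∫⁻ x, ENNReal.ofReal (f x)) + ENNReal.ofReal q *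
      (∫⁻ x, ENNReal.ofReal (g x)) ≤ ∫⁻ x, ENNReal.ofReal (h x) := by
  rw [lintegral_eq_lintegral_meas_lt _ (.of_forall hf0) hf.aemeasurable,
    lintegral_eq_lintegral_meas_lt _ (.of_forall hg0) hg.aemeasurable,
    lintegral_eq_lintegral_meas_lt _ (.of_forall hh0) hh.aemeasurable,
    ← lintegral_const_mul' _ _ ENNReal.ofReal_ne_top,
    ← lintegral_const_mul' _ _ ENNReal.ofReal_ne_top]
  have hmeas : Measurable fun t : ℝ => ENNReal.ofReal p * volume {a | t < f a} := by
    refine Measurable.const_mul (Antitone.measurable fun s t hst => measure_mono ?_) _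
    exact fun x hx => lt_of_le_of_lt hst hx
  rw [← lintegral_add_left hmeas]
  refine setLIntegral_mono' measurableSet_Ioi fun t (ht : 0 < t) => ?_
  rcases lt_or_ge t 1 with ht1 | ht1
  · refine volume_combo_le hp hq (measurableSet_lt measurable_const hf)
      (measurableSet_lt measurable_const hg) (hfs t ht1) (hgs t ht1) ?_
    intro a (ha : t < f a) b (hb : t < g b)
    refine lt_of_lt_of_le ?_ (hfgh a b)
    calc t = t ^ p * t ^ q := by rw [← Real.rpow_add ht, hpq, Real.rpow_one]
      _ < f a ^ p * g b ^ q :=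
        mul_lt_mul'' (Real.rpow_lt_rpow ht.le ha hp) (Real.rpow_lt_rpow ht.le hb hq)
          (Real.rpow_nonneg ht.le _) (Real.rpow_nonneg ht.le _)
  · have e1 : {a | t < f a} = ∅ := eq_empty_of_forall_notMem
      fun x (hx : t < f x) => absurd (hf1 x) (not_le.2 (ht1.trans_lt hx))
    have e2 : {a | t < g a} = ∅ := eq_empty_of_forall_notMem
      fun x (hx : t < g x) => absurd (hg1 x) (not_le.2 (ht1.trans_lt hx))
    simp [e1, e2]

/-- The Prékopa–Leindler inequality holds on the measure space `X`. -/
def PrekopaLeindler (X : Type*) [MeasureSpace X] [AddCommGroup X] [Module ℝ X] : Prop :=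
  ∀ ⦃p q : ℝ⦄, 0 < p → 0 < q → p + q = 1 → ∀ ⦃f g h : X → ℝ≥0∞⦄,
    Measurable f → Measurable g → Measurable h →
    (∀ x y, f x ^ p * g y ^ q ≤ h (p • x + q • y)) →
    (∫⁻ x, f x) ^ p * (∫⁻ x, g x) ^ q ≤ ∫⁻ x, h x

lemma ennreal_geom_mean_le {p q : ℝ} (hp : 0 < p) (hq : 0 < q) (hpq : p + q = 1) (a b : ℝ≥0∞) :
    a ^ p * b ^ q ≤ ENNReal.ofReal p * a + ENNReal.ofReal q * b := by
  rcases eq_or_ne a ⊤ with rfl | ha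
  · simp [ENNReal.mul_top, hp]
  rcases eq_or_ne b ⊤ with rfl | hb
  · simp [ENNReal.mul_top, hq]
  have h := Real.geom_mean_le_arith_mean2_weighted hp.le hq.le (p₁ := a.toReal) (p₂ := b.toReal)
    ENNReal.toReal_nonneg ENNReal.toReal_nonneg hpq
  have := ENNReal.ofReal_le_ofReal h
  rwa [ENNReal.ofReal_mul (by positivity), ENNReal.ofReal_add (by positivity) (by positivity),
    ENNReal.ofReal_mul hp.le, ENNReal.ofReal_mul hq.le,
    ← ENNReal.ofReal_rpow_of_nonneg ENNReal.toReal_nonneg hp.le,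
    ← ENNReal.ofReal_rpow_of_nonneg ENNReal.toReal_nonneg hq.le,
    ENNReal.ofReal_toReal ha, ENNReal.ofReal_toReal hb] at this

/-- The one-dimensional Prékopa–Leindler inequality for bounded functions: both functions are
divided by their suprema, so that the additive form applies. -/
lemma prekopaLeindler_real_of_bounded {p q : ℝ} (hp : 0 < p) (hq : 0 < q) (hpq : p + q = 1)
    {f g h : ℝ → ℝ≥0∞} (hf : Measurable f) (hg : Measurable g) (hh : Measurable h)
    {k : ℝ≥0∞} (hk : k ≠ ⊤) (hfk : ∀ x, f x ≤ k) (hgk : ∀ x, g x ≤ k)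
    (hfgh : ∀ x y, f x ^ p * g y ^ q ≤ h (p * x + q * y)) :
    (∫⁻ x, f x) ^ p * (∫⁻ x, g x) ^ q ≤ ∫⁻ x, h x := by
  have hAt : (⨆ x, f x) ≠ ⊤ := ne_top_of_le_ne_top hk (iSup_le hfk)
  have hBt : (⨆ x, g x) ≠ ⊤ := ne_top_of_le_ne_top hk (iSup_le hgk)
  have hfA : ∀ x, f x ≤ ⨆ x, f x := le_iSup f
  have hgB : ∀ x, g x ≤ ⨆ x, g x := le_iSup g
  have hAl : ∀ t < ⨆ x, f x, ∃ x, t < f x := fun t ht => lt_iSup_iff.1 ht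
  have hBl : ∀ t < ⨆ x, g x, ∃ x, t < g x := fun t ht => lt_iSup_iff.1 ht
  generalize (⨆ x, f x) = A at *
  generalize (⨆ x, g x) = B at *
  rcases eq_or_ne A 0 with rfl | hA0
  · simp [show ∀ x, f x = 0 from fun x => le_antisymm (hfA x) bot_le, hp]
  rcases eq_or_ne B 0 with rfl | hB0
  · simp [show ∀ x, g x = 0 from fun x => le_antisymm (hgB x) bot_le, hq]
  set N : ℝ≥0∞ := A ^ p * B ^ q with hN
  have hAp0 : A ^ p ≠ 0 := by simp [ENNReal.rpow_eq_zero_iff, hA0, hAt]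
  have hBq0 : B ^ q ≠ 0 := by simp [ENNReal.rpow_eq_zero_iff, hB0, hBt]
  have hApt : A ^ p ≠ ⊤ := ENNReal.rpow_ne_top_of_nonneg hp.le hAt
  have hBqt : B ^ q ≠ ⊤ := ENNReal.rpow_ne_top_of_nonneg hq.le hBt
  have hN0 : N ≠ 0 := mul_ne_zero hAp0 hBq0
  have hNt : N ≠ ⊤ := ENNReal.mul_ne_top hApt hBqt
  have hf1 : ∀ x, f x / A ≤ 1 := fun x => ENNReal.div_le_of_le_mul (by simpa using hfA x)
  have hg1 : ∀ x, g x / B ≤ 1 := fun x => ENNReal.div_le_of_le_mul (by simpa using hgB x)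
  have hft : ∀ x, f x / A ≠ ⊤ := fun x => ne_top_of_le_ne_top ENNReal.one_ne_top (hf1 x)
  have hgt : ∀ x, g x / B ≠ ⊤ := fun x => ne_top_of_le_ne_top ENNReal.one_ne_top (hg1 x)
  have hht : ∀ x, min (h x / N) 1 ≠ ⊤ := fun x =>
    ne_top_of_le_ne_top ENNReal.one_ne_top (min_le_right _ _)
  have sup_aux : ∀ (φ : ℝ → ℝ≥0∞) (S : ℝ≥0∞), S ≠ 0 → S ≠ ⊤ → (∀ t < S, ∃ x, t < φ x) →
      (∀ x, φ x / S ≠ ⊤) → ∀ t < (1 : ℝ), ∃ x, t < (φ x / S).toReal := by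
    intro φ S hS0 hSt hφ hφt t ht
    have : ENNReal.ofReal t * S < S := by
      calc ENNReal.ofReal t * S < 1 * S := by
            refine ENNReal.mul_lt_mul_left hS0 hSt ?_
            simpa using ht
        _ = S := one_mul _
    obtain ⟨x, hx⟩ := hφ _ this
    rw [← ENNReal.lt_div_iff_mul_lt (.inl hS0) (.inl hSt), ← ENNReal.ofReal_toReal (hφt x)] at hx
    exact ⟨x, (ENNReal.ofReal_lt_ofReal_iff'.1 hx).1⟩
  have key := lintegral_combo_le_of_sup_eq_one hp hq hpq
    (f := fun x => (f x / A).toReal) (g := fun x => (g x / B).toReal)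
    (h := fun x => (min (h x / N) 1).toReal)
    (hf.div_const _).ennreal_toReal (hg.div_const _).ennreal_toReal
    ((hh.div_const _).min measurable_const).ennreal_toReal
    (fun _ => ENNReal.toReal_nonneg) (fun _ => ENNReal.toReal_nonneg)
    (fun _ => ENNReal.toReal_nonneg)
    (fun x => ENNReal.toReal_le_of_le_ofReal zero_le_one (by simpa using hf1 x))
    (fun x => ENNReal.toReal_le_of_le_ofReal zero_le_one (by simpa using hg1 x))
    (sup_aux f A hA0 hAt hAl hft) (sup_aux g B hB0 hBt hBl hgt) (by
      intro x y
      rw [ENNReal.toReal_rpow, ENNReal.toReal_rpow, ← ENNReal.toReal_mul]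
      refine ENNReal.toReal_mono (hht _) (le_min ?_ ?_)
      · rw [ENNReal.div_rpow_of_nonneg _ _ hp.le, ENNReal.div_rpow_of_nonneg _ _ hq.le, hN]
        calc f x ^ p / A ^ p * (g y ^ q / B ^ q) = (f x ^ p * g y ^ q) / (A ^ p * B ^ q) := by
              simp only [div_eq_mul_inv]
              rw [ENNReal.mul_inv (.inl hAp0) (.inl hApt)]
              ring
          _ ≤ _ := ENNReal.div_le_div_right (hfgh x y) _
      · exact mul_le_one' (ENNReal.rpow_le_one (hf1 x) hp.le) (ENNReal.rpow_le_one (hg1 y) hq.le))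
  simp only [ENNReal.ofReal_toReal (hft _), ENNReal.ofReal_toReal (hgt _),
    ENNReal.ofReal_toReal (hht _)] at key
  have key2 := (ennreal_geom_mean_le hp hq hpq _ _).trans key
  have hle : ∫⁻ x, min (h x / N) 1 ≤ (∫⁻ x, h x) / N := by
    simp only [div_eq_mul_inv]
    rw [← lintegral_mul_const _ hh]
    exact lintegral_mono fun x => min_le_left _ _
  have key3 := key2.trans hle
  simp only [div_eq_mul_inv] at key3
  rw [lintegral_mul_const _ hf, lintegral_mul_const _ hg, ← div_eq_mul_inv, ← div_eq_mul_inv,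
    ← div_eq_mul_inv, ENNReal.div_rpow_of_nonneg _ _ hp.le, ENNReal.div_rpow_of_nonneg _ _ hq.le,
    ENNReal.le_div_iff_mul_le (.inl hN0) (.inl hNt)] at key3
  refine le_trans (le_of_eq ?_) key3
  rw [hN]
  calc (∫⁻ x, f x) ^ p * (∫⁻ x, g x) ^ q
      = ((∫⁻ x, f x) ^ p / A ^ p * A ^ p) * ((∫⁻ x, g x) ^ q / B ^ q * B ^ q) := by
        rw [ENNReal.div_mul_cancel hAp0 hApt, ENNReal.div_mul_cancel hBq0 hBqt]
    _ = _ := by ring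

lemma prekopaLeindler_real : PrekopaLeindler ℝ := by
  intro p q hp hq hpq f g h hf hg hh hfgh
  have htrunc : ∀ φ : ℝ → ℝ≥0∞, Measurable φ →
      Tendsto (fun k : ℕ => ∫⁻ x, min (φ x) k) atTop (𝓝 (∫⁻ x, φ x)) := by
    intro φ hφ
    refine lintegral_tendsto_of_tendsto_of_monotone
      (fun k => (hφ.min measurable_const).aemeasurable) (.of_forall fun x => ?_)
      (.of_forall fun x => ?_)
    · exact fun i j hij => min_le_min_left _ (by exact_mod_cast hij)
    · have : Tendsto (fun k : ℕ => min (φ x) (k : ℝ≥0∞)) atTop (𝓝 (min (φ x) ⊤)) :=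
        tendsto_const_nhds.min ENNReal.tendsto_nat_nhds_top
      simpa using this
  rcases eq_or_ne (∫⁻ x, f x) 0 with hf0 | hf0
  · simp [hf0, hp]
  rcases eq_or_ne (∫⁻ x, g x) 0 with hg0 | hg0
  · simp [hg0, hq]
  have hlim := ENNReal.Tendsto.mul
    ((ENNReal.continuous_rpow_const (y := p)).tendsto _ |>.comp (htrunc f hf))
    (.inl (by simp [ENNReal.rpow_eq_zero_iff, hf0, hp.le]))
    ((ENNReal.continuous_rpow_const (y := q)).tendsto _ |>.comp (htrunc g hg))
    (.inl (by simp [ENNReal.rpow_eq_zero_iff, hg0, hq.le]))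
  refine le_of_tendsto' hlim fun k => ?_
  refine prekopaLeindler_real_of_bounded hp hq hpq (hf.min measurable_const)
    (hg.min measurable_const) hh (ENNReal.natCast_ne_top k) (fun x => min_le_right _ _)
    (fun x => min_le_right _ _) fun x y => le_trans ?_ (hfgh x y)
  exact mul_le_mul' (ENNReal.rpow_le_rpow (min_le_left _ _) hp.le)
    (ENNReal.rpow_le_rpow (min_le_left _ _) hq.le)

lemma PrekopaLeindler.prod {X Y : Type*} [MeasureSpace X] [AddCommGroup X] [Module ℝ X]
    [MeasureSpace Y] [AddCommGroup Y] [Module ℝ Y] [SFinite (volume : Measure Y)]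
    (hX : PrekopaLeindler X) (hY : PrekopaLeindler Y) : PrekopaLeindler (X × Y) := by
  intro p q hp hq hpq f g h hf hg hh hfgh
  have e : ∀ φ : X × Y → ℝ≥0∞, Measurable φ → ∫⁻ z, φ z = ∫⁻ x, ∫⁻ y, φ (x, y) :=
    fun φ hφ => lintegral_prod _ hφ.aemeasurable
  rw [e f hf, e g hg, e h hh]
  refine hX hp hq hpq hf.lintegral_prod_right' hg.lintegral_prod_right' hh.lintegral_prod_right'
    fun x x' => ?_
  exact hY hp hq hpq (hf.comp measurable_prodMk_left) (hg.comp measurable_prodMk_left)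
    (hh.comp measurable_prodMk_left) fun y y' => hfgh (x, y) (x', y')

lemma PrekopaLeindler.of_measurePreserving {X Y : Type*} [MeasureSpace X] [AddCommGroup X]
    [Module ℝ X] [MeasureSpace Y] [AddCommGroup Y] [Module ℝ Y] (hX : PrekopaLeindler X)
    (e : X ≃ᵐ Y) (he : MeasurePreserving e) (hlin : IsLinearMap ℝ e) : PrekopaLeindler Y := by
  intro p q hp hq hpq f g h hf hg hh hfgh
  rw [← he.lintegral_comp hf, ← he.lintegral_comp hg, ← he.lintegral_comp hh]
  refine hX hp hq hpq (hf.comp e.measurable) (hg.comp e.measurable) (hh.comp e.measurable) ?_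
  intro x y
  simpa [hlin.map_add, hlin.map_smul] using hfgh (e x) (e y)

lemma prekopaLeindler_pi (n : ℕ) : PrekopaLeindler (Fin n → ℝ) := by
  induction n with
  | zero =>
    intro p q hp hq hpq f g h hf hg hh hfgh
    have := hfgh 0 0
    rw [Subsingleton.elim (p • (0 : Fin 0 → ℝ) + q • 0) 0] at this
    simpa [volume_pi, Measure.pi_of_empty _ (0 : Fin 0 → ℝ), lintegral_dirac' _ hf,
      lintegral_dirac' _ hg, lintegral_dirac' _ hh] using this
  | succ n ih =>
    refine (prekopaLeindler_real.prod ih).of_measurePreserving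
      (MeasurableEquiv.piFinSuccAbove (fun _ => ℝ) 0).symm
      (volume_preserving_piFinSuccAbove (fun _ => ℝ) 0).symm ⟨?_, ?_⟩
    · intro x y
      ext i
      refine Fin.cases ?_ (fun j => ?_) i <;> simp [MeasurableEquiv.piFinSuccAbove]
    · intro c x
      ext i
      refine Fin.cases ?_ (fun j => ?_) i <;> simp [MeasurableEquiv.piFinSuccAbove]

/-! ### The Brunn–Minkowski inequality -/

section BrunnMinkowski

variable {X : Type*} [NormedAddCommGroup X] [NormedSpace ℝ X] [MeasureSpace X]

/-- The Brunn–Minkowski inequality in its multiplicative form. -/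
lemma PrekopaLeindler.measure_rpow_mul_le (hX : PrekopaLeindler X) {p q : ℝ} (hp : 0 < p)
    (hq : 0 < q) (hpq : p + q = 1) {A B C : Set X} (hA : MeasurableSet A) (hB : MeasurableSet B)
    (hC : MeasurableSet C) (h : ∀ a ∈ A, ∀ b ∈ B, p • a + q • b ∈ C) :
    volume A ^ p * volume B ^ q ≤ volume C := by
  have := hX hp hq hpq (f := A.indicator 1) (g := B.indicator 1) (h := C.indicator 1)
    (measurable_one.indicator hA) (measurable_one.indicator hB) (measurable_one.indicator hC) (by
      intro x y
      by_cases hx : x ∈ A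
      · by_cases hy : y ∈ B
        · simp [hx, hy, h x hx y hy]
        · simp [hy, hq]
      · simp [hx, hp])
  simpa [lintegral_indicator_one, hA, hB, hC] using this

/-- The Brunn–Minkowski inequality in its additive form follows from the multiplicative one by
rescaling both sets to volume one. -/
lemma PrekopaLeindler.brunnMinkowski (hX : PrekopaLeindler X) [BorelSpace X]
    [FiniteDimensional ℝ X] [(volume : Measure X).IsAddHaarMeasure] {d : ℕ} (hd : 0 < d)
    (hdX : Module.finrank ℝ X = d) {p q : ℝ} (hp : 0 < p) (hq : 0 < q)
    {A B C : Set X} (hA : MeasurableSet A) (hB : MeasurableSet B)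
    (hC : MeasurableSet C) (hCfin : volume C ≠ ⊤) (hA0 : 0 < volume.real A)
    (hB0 : 0 < volume.real B) (h : ∀ a ∈ A, ∀ b ∈ B, p • a + q • b ∈ C) :
    p * volume.real A ^ (1 / d : ℝ) + q * volume.real B ^ (1 / d : ℝ) ≤
      volume.real C ^ (1 / d : ℝ) := by
  have hd' : (d : ℝ) ≠ 0 := by positivity
  set α := volume.real A ^ (1 / d : ℝ) with hα
  set β := volume.real B ^ (1 / d : ℝ) with hβ
  have hα0 : 0 < α := Real.rpow_pos_of_pos hA0 _
  have hβ0 : 0 < β := Real.rpow_pos_of_pos hB0 _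
  have hαd : α ^ d = volume.real A := by
    rw [hα, ← Real.rpow_mul_natCast hA0.le]; simp [hd']
  have hβd : β ^ d = volume.real B := by
    rw [hβ, ← Real.rpow_mul_natCast hB0.le]; simp [hd']
  set S := p * α + q * β with hS
  have hS0 : 0 < S := by positivity
  have scale : ∀ (T : Set X) (r : ℝ), 0 < r →
      volume.real (r⁻¹ • T) = volume.real T / r ^ d := by
    intro T r hr
    simp only [measureReal_def]
    rw [Measure.addHaar_smul, hdX, ENNReal.toReal_mul, ENNReal.toReal_ofReal (abs_nonneg _),
      abs_of_pos (by positivity), inv_pow, div_eq_inv_mul]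
  have key := hX.measure_rpow_mul_le (p := p * α / S) (q := q * β / S) (by positivity)
    (by positivity) (by rw [← add_div, ← hS, div_self hS0.ne'])
    (hA.const_smul_of_ne_zero (inv_ne_zero hα0.ne'))
    (hB.const_smul_of_ne_zero (inv_ne_zero hβ0.ne'))
    (hC.const_smul_of_ne_zero (inv_ne_zero hS0.ne')) (by
      rintro _ ⟨a, ha, rfl⟩ _ ⟨b, hb, rfl⟩
      refine ⟨p • a + q • b, h a ha b hb, ?_⟩
      simp only [smul_add, smul_smul]
      congr 2 <;> field_simp)
  have hfin : volume (S⁻¹ • C) ≠ ⊤ := by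
    rw [Measure.addHaar_smul]; exact ENNReal.mul_ne_top ENNReal.ofReal_ne_top hCfin
  have key2 := ENNReal.toReal_mono hfin key
  rw [ENNReal.toReal_mul, ← ENNReal.toReal_rpow, ← ENNReal.toReal_rpow] at key2
  simp only [← measureReal_def] at key2
  rw [scale _ _ hα0, scale _ _ hβ0, scale _ _ hS0, hαd, hβd, div_self hA0.ne', div_self hB0.ne',
    Real.one_rpow, Real.one_rpow, mul_one, le_div_iff₀ (by positivity), one_mul] at key2
  calc S = (S ^ d) ^ (1 / d : ℝ) := by
        rw [← Real.rpow_natCast, ← Real.rpow_mul hS0.le]; simp [hd']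
    _ ≤ _ := Real.rpow_le_rpow (by positivity) key2 (by positivity)

end BrunnMinkowski

/-! ### One-dimensional inequalities for distribution functions -/

/-- A comparison form of the fundamental theorem of calculus, with its equality case. -/
lemma sub_le_integral_and_eq {a b : ℝ} (hab : a < b) {R r φ : ℝ → ℝ}
    (hR : ContinuousOn R (Icc a b)) (hφ : ContinuousOn φ (Icc a b))
    (hd : ∀ s ∈ Ioo a b, HasDerivAt R (r s) s) (hle : ∀ s ∈ Ioo a b, r s ≤ φ s) :
    R b - R a ≤ ∫ s in a..b, φ s ∧
      (R b - R a = ∫ s in a..b, φ s → ∀ s ∈ Ioo a b, r s = φ s) := by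
  have hint : ∀ {x y}, a ≤ x → x ≤ y → y ≤ b → IntervalIntegrable φ volume x y :=
    fun hx hxy hy => ContinuousOn.intervalIntegrable_of_Icc hxy (hφ.mono (Icc_subset_Icc hx hy))
  have hsub : ∀ {x y}, a ≤ x → x ≤ y → y ≤ b → R y - R x ≤ ∫ s in x..y, φ s := by
    intro x y hx hxy hy
    refine intervalIntegral.sub_le_integral_of_hasDeriv_right_of_le hxy
      (hR.mono (Icc_subset_Icc hx hy)) (g' := r) (fun s hs => ?_)
      ((hφ.mono (Icc_subset_Icc hx hy)).integrableOn_Icc) (fun s hs => ?_)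
    · exact (hd s ⟨hx.trans_lt hs.1, hs.2.trans_le hy⟩).hasDerivWithinAt
    · exact hle s ⟨hx.trans_lt hs.1, hs.2.trans_le hy⟩
  refine ⟨hsub le_rfl hab.le le_rfl, fun heq s hs => ?_⟩
  have hval : ∀ t ∈ Icc a b, R t = R a + ∫ s in a..t, φ s := by
    intro t ht
    have h1 := hsub le_rfl ht.1 ht.2
    have h2 := hsub ht.1 ht.2 le_rfl
    have h3 := intervalIntegral.integral_add_adjacent_intervals (hint le_rfl ht.1 ht.2)
      (hint ht.1 ht.2 le_rfl)
    linarith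
  have hcont : ContinuousAt φ s := hφ.continuousAt (Icc_mem_nhds hs.1 hs.2)
  have hder : HasDerivAt (fun t => R a + ∫ u in a..t, φ u) (φ s) s := by
    refine (intervalIntegral.integral_hasDerivAt_right (hint le_rfl hs.1.le hs.2.le) ?_
      hcont).const_add _
    exact (hφ.mono Ioo_subset_Icc_self).stronglyMeasurableAtFilter isOpen_Ioo s hs
  refine (hd s hs).unique (hder.congr_of_eventuallyEq ?_)
  filter_upwards [Icc_mem_nhds hs.1 hs.2] with t ht using hval t ht

/-- The constant `(3d+1) / (2(d+1)(2d+1))` of the lower bound. -/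
noncomputable def lowerConst (d : ℕ) : ℝ := (3 * (d : ℝ) + 1) / (2 * ((d : ℝ) + 1) * (2 * (d : ℝ) + 1))

lemma lowerConst_pos (d : ℕ) : 0 < lowerConst d := by unfold lowerConst; positivity

lemma lowerConst_lt_half {d : ℕ} (hd : 1 ≤ d) : lowerConst d < 1 / 2 := by
  have : (1 : ℝ) ≤ d := by exact_mod_cast hd
  unfold lowerConst
  rw [div_lt_div_iff₀ (by positivity) (by positivity)]
  nlinarith

lemma strictMonoOn_of_hasDerivAt_pos {a b : ℝ} {F f : ℝ → ℝ} (hF : ContinuousOn F (Icc a b))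
    (hd : ∀ s ∈ Ioo a b, HasDerivAt F (f s) s) (hf : ∀ s ∈ Ioo a b, 0 < f s) :
    StrictMonoOn F (Icc a b) := by
  refine strictMonoOn_of_deriv_pos (convex_Icc a b) hF fun s hs => ?_
  rw [interior_Icc] at hs
  rw [(hd s hs).deriv]; exact hf s hs

/-- The lower bound up to the median: since `D = G ^ (1/d)` is concave, `2G(1-G) - C` may be
compared with `(2G(1-G) - C) D' / D'(s₀)`, where `s₀` is the zero of `2G(1-G) - C`; the integral of
the latter function vanishes by the choice of `C`. -/
lemma lowerConst_mul_le_integral_of_half {d : ℕ} (hd : 1 ≤ d) {a m : ℝ} (ham : a < m)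
    {G g : ℝ → ℝ} (hGc : ContinuousOn G (Icc a m)) (hGa : G a = 0) (hGm : G m = 1 / 2)
    (hG : ∀ s ∈ Ioo a m, HasDerivAt G (g s) s) (hg : ∀ s ∈ Ioo a m, 0 < g s)
    (hconc : ConcaveOn ℝ (Ioo a m) fun s => G s ^ (1 / d : ℝ)) :
    lowerConst d * (m - a) ≤ (∫ s in a..m, 2 * G s * (1 - G s)) ∧
      (lowerConst d * (m - a) = (∫ s in a..m, 2 * G s * (1 - G s)) →
        ∃ k > 0, ∀ s ∈ Ioo a m, G s = (k * (s - a)) ^ d) := by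
  have hd0 : (d : ℝ) ≠ 0 := by positivity
  have hd1 : (0 : ℝ) < 1 / d := by positivity
  set C := lowerConst d with hC
  have hC0 : 0 < C := lowerConst_pos d
  have hC2 : C < 1 / 2 := lowerConst_lt_half hd
  have hmono := strictMonoOn_of_hasDerivAt_pos hGc hG hg
  have hpos : ∀ s ∈ Ioo a m, 0 < G s := fun s hs => by
    rw [← hGa]
    exact hmono (left_mem_Icc.2 ham.le) (Ioo_subset_Icc_self hs) hs.1
  have hlt : ∀ s ∈ Ioo a m, G s < 1 / 2 := fun s hs => by
    rw [← hGm]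
    exact hmono (Ioo_subset_Icc_self hs) (right_mem_Icc.2 ham.le) hs.2
  obtain ⟨s₀, hs₀, hs₀C⟩ : ∃ s₀ ∈ Ioo a m, 2 * G s₀ * (1 - G s₀) = C := by
    have hc : ContinuousOn (fun s => 2 * G s * (1 - G s)) (Icc a m) := by fun_prop
    have := intermediate_value_Ioo ham.le hc
    refine this ⟨?_, ?_⟩
    · simpa [hGa] using hC0
    · rw [hGm]; linarith
  set D : ℝ → ℝ := fun s => G s ^ (1 / d : ℝ) with hD
  set D' : ℝ → ℝ := fun s => g s * (1 / d) * G s ^ (1 / d - 1 : ℝ) with hD'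
  have hDderiv : ∀ s ∈ Ioo a m, HasDerivAt D (D' s) s := fun s hs =>
    (hG s hs).rpow_const (.inl (hpos s hs).ne')
  have hDc : ContinuousOn D (Icc a m) := hGc.rpow_const fun s _ => .inr hd1.le
  have hD'pos : ∀ s ∈ Ioo a m, 0 < D' s := fun s hs => by
    have := hpos s hs
    have := hg s hs
    positivity
  have hDpow : ∀ s ∈ Icc a m, D s ^ d = G s := fun s hs => by
    have : 0 ≤ G s := by
      rw [← hGa]; exact hmono.monotoneOn (left_mem_Icc.2 ham.le) hs hs.1
    simp only [hD]
    rw [← Real.rpow_mul_natCast this]; simp [hd0]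
  have hanti : AntitoneOn D' (Ioo a m) := by
    have := hconc.antitoneOn_deriv fun s hs => (hDderiv s hs).differentiableAt
    intro x hx y hy hxy
    have h := this hx hy hxy
    rwa [(hDderiv x hx).deriv, (hDderiv y hy).deriv] at h
  set k := D' s₀ with hk
  have hk0 : 0 < k := hD'pos s₀ hs₀
  set P : ℝ → ℝ := fun x =>
    2 * x ^ (d + 1) / (d + 1) - 2 * x ^ (2 * d + 1) / (2 * d + 1) - C * x with hP
  have hPderiv : ∀ x, HasDerivAt P (2 * x ^ d * (1 - x ^ d) - C) x := by
    intro x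
    have h1 := ((hasDerivAt_pow (d + 1) x).const_mul 2).div_const ((d : ℝ) + 1)
    have h2 := ((hasDerivAt_pow (2 * d + 1) x).const_mul 2).div_const (2 * (d : ℝ) + 1)
    have h3 := (hasDerivAt_id x).const_mul C
    refine ((h1.sub h2).sub h3).congr_deriv ?_
    push_cast
    have : (2 * (d : ℝ) + 1) ≠ 0 := by positivity
    field_simp
    ring
  have hPc : Continuous P := by fun_prop
  have hRderiv : ∀ s ∈ Ioo a m, HasDerivAt (fun s => P (D s) / k)
      ((2 * G s * (1 - G s) - C) * D' s / k) s := by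
    intro s hs
    have := ((hPderiv (D s)).comp s (hDderiv s hs)).div_const k
    rw [hDpow s (Ioo_subset_Icc_self hs)] at this
    exact this
  have hsign : ∀ s ∈ Ioo a m, (2 * G s * (1 - G s) - C) * D' s / k ≤ 2 * G s * (1 - G s) - C := by
    intro s hs
    rw [div_le_iff₀ hk0]
    have h0 := hlt s₀ hs₀
    have h1 := hlt s hs
    rcases le_total s s₀ with h | h
    · have hGle := hmono.monotoneOn (Ioo_subset_Icc_self hs) (Ioo_subset_Icc_self hs₀) h
      have : 2 * G s * (1 - G s) - C ≤ 0 := by nlinarith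
      exact mul_le_mul_of_nonpos_left (hanti hs hs₀ h) this
    · have hGle := hmono.monotoneOn (Ioo_subset_Icc_self hs₀) (Ioo_subset_Icc_self hs) h
      have : 0 ≤ 2 * G s * (1 - G s) - C := by nlinarith
      exact mul_le_mul_of_nonneg_left (hanti hs₀ hs h) this
  obtain ⟨hle, heq⟩ := sub_le_integral_and_eq ham (hPc.comp_continuousOn hDc |>.div_const k)
    (φ := fun s => 2 * G s * (1 - G s) - C) (by fun_prop) hRderiv hsign
  have hDa : D a = 0 := by simp [hD, hGa, hd0]
  have hPa : P (D a) = 0 := by simp [hDa, hP]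
  have hPm : P (D m) = 0 := by
    have h1 := hDpow m (right_mem_Icc.2 ham.le)
    rw [hGm] at h1
    simp only [hP]
    rw [pow_succ, show D m ^ (2 * d + 1) = (D m ^ d) ^ 2 * D m by ring, h1, hC, lowerConst]
    have : (2 * (d : ℝ) + 1) ≠ 0 := by positivity
    field_simp
    ring
  have hint : (∫ s in a..m, (2 * G s * (1 - G s) - C)) =
      (∫ s in a..m, 2 * G s * (1 - G s)) - C * (m - a) := by
    rw [intervalIntegral.integral_sub, intervalIntegral.integral_const, smul_eq_mul, mul_comm C]
    · exact ContinuousOn.intervalIntegrable_of_Icc ham.le (by fun_prop)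
    · exact intervalIntegrable_const
  simp only [Function.comp_apply, hPa, hPm, zero_div, sub_zero, hint] at hle heq
  refine ⟨by linarith, fun h => ⟨k, hk0, ?_⟩⟩
  have heq' := heq (by linarith)
  have hD'k : ∀ s ∈ Ioo a m, D' s = k := by
    intro s hs
    rcases eq_or_ne s s₀ with rfl | hne
    · rfl
    have h1 := heq' s hs
    rw [div_eq_iff hk0.ne'] at h1
    refine mul_left_cancel₀ ?_ h1
    intro h0
    have h2 := hlt s hs
    have h3 := hlt s₀ hs₀
    have h4 : (G s - G s₀) * (1 - G s - G s₀) = 0 := by nlinarith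
    rcases mul_eq_zero.1 h4 with h5 | h5
    · exact hne (hmono.injOn (Ioo_subset_Icc_self hs) (Ioo_subset_Icc_self hs₀) (by linarith))
    · linarith
  intro s hs
  have hlin : D s = k * (s - a) := by
    obtain ⟨c, hc, hcs⟩ := exists_hasDerivAt_eq_slope D D' hs.1
      (hDc.mono (Icc_subset_Icc_right hs.2.le)) fun x hx => hDderiv x ⟨hx.1, hx.2.trans hs.2⟩
    rw [hD'k c ⟨hc.1, hc.2.trans hs.2⟩, hDa, eq_div_iff (by linarith [hs.1])] at hcs
    linarith
  rw [← hDpow s (Ioo_subset_Icc_self hs), hlin]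

/-- The lower bound, from the bound for `F` to the left of the median and the bound for the
reflection of `1 - F` to the right of it. -/
lemma lowerConst_mul_le_integral {d : ℕ} (hd : 1 ≤ d) {a b : ℝ} (hab : a < b)
    {F f : ℝ → ℝ} (hFc : ContinuousOn F (Icc a b)) (hFa : F a = 0) (hFb : F b = 1)
    (hF : ∀ s ∈ Ioo a b, HasDerivAt F (f s) s) (hf : ∀ s ∈ Ioo a b, 0 < f s)
    (hconc : ConcaveOn ℝ (Ioo a b) fun s => F s ^ (1 / d : ℝ))
    (hconc' : ConcaveOn ℝ (Ioo a b) fun s => (1 - F s) ^ (1 / d : ℝ)) :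
    lowerConst d * (b - a) ≤ (∫ s in a..b, 2 * F s * (1 - F s)) ∧
      (lowerConst d * (b - a) = (∫ s in a..b, 2 * F s * (1 - F s)) →
        ∃ k > 0, ∃ m < b, ∀ s ∈ Ioo m b, 1 - F s = (k * (b - s)) ^ d) := by
  obtain ⟨m, hm, hFm⟩ : ∃ m ∈ Ioo a b, F m = 1 / 2 := by
    refine intermediate_value_Ioo hab.le hFc ⟨?_, ?_⟩
    · rw [hFa]; norm_num
    · rw [hFb]; norm_num
  have hL := lowerConst_mul_le_integral_of_half hd hm.1 (hFc.mono (Icc_subset_Icc_right hm.2.le))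
    hFa hFm (fun s hs => hF s ⟨hs.1, hs.2.trans hm.2⟩) (fun s hs => hf s ⟨hs.1, hs.2.trans hm.2⟩)
    (hconc.subset (Ioo_subset_Ioo_right hm.2.le) (convex_Ioo _ _))
  have hmaps : MapsTo (fun s : ℝ => -s) (Icc (-b) (-m)) (Icc m b) := by
    intro s hs; constructor <;> linarith [hs.1, hs.2]
  have hR := lowerConst_mul_le_integral_of_half hd (a := -b) (m := -m) (by linarith [hm.2])
    (G := fun s => 1 - F (-s)) (g := fun s => f (-s))
    (continuousOn_const.sub ((hFc.mono (Icc_subset_Icc_left hm.1.le)).comp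
      continuous_neg.continuousOn hmaps)) (by simp [hFb]) (by simp [hFm]; norm_num)
    (by
      intro s hs
      have h := (hF (-s) ⟨by linarith [hs.2, hm.1], by linarith [hs.1]⟩).comp s (hasDerivAt_neg s)
      simpa using h.const_sub 1)
    (fun s hs => hf (-s) ⟨by linarith [hs.2, hm.1], by linarith [hs.1]⟩)
    (by
      refine ⟨convex_Ioo _ _, fun x hx y hy p q hp hq hpq => ?_⟩
      have := hconc'.2 (x := -x) ⟨by linarith [hx.2, hm.1], by linarith [hx.1]⟩ (y := -y)
        ⟨by linarith [hy.2, hm.1], by linarith [hy.1]⟩ hp hq hpq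
      simp only [smul_eq_mul] at this ⊢
      convert this using 4
      ring)
  have hi : (∫ s in (-b)..(-m), 2 * (1 - F (-s)) * (1 - (1 - F (-s)))) =
      ∫ s in m..b, 2 * F s * (1 - F s) := by
    have := intervalIntegral.integral_comp_neg (a := -b) (b := -m)
      (fun s => 2 * F s * (1 - F s))
    rw [neg_neg, neg_neg] at this
    rw [← this]
    congr 1; ext s; ring
  rw [hi] at hR
  have hc : ContinuousOn (fun s => 2 * F s * (1 - F s)) (Icc a b) := by fun_prop
  have hadd := intervalIntegral.integral_add_adjacent_intervals (μ := volume)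
    (ContinuousOn.intervalIntegrable_of_Icc hm.1.le (hc.mono (Icc_subset_Icc_right hm.2.le)))
    (ContinuousOn.intervalIntegrable_of_Icc hm.2.le (hc.mono (Icc_subset_Icc_left hm.1.le)))
  have e : lowerConst d * (-m - -b) = lowerConst d * (b - m) := by ring
  rw [e] at hR
  refine ⟨by linarith [hL.1, hR.1], fun heq => ?_⟩
  obtain ⟨k, hk, hks⟩ := hR.2 (by linarith [hL.1, hR.1])
  refine ⟨k, hk, m, hm.2, fun s hs => ?_⟩
  have := hks (-s) ⟨by linarith [hs.2], by linarith [hs.1]⟩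
  rw [neg_neg] at this
  rw [this]; congr 1; ring

/-- A concave function `v` has a supergradient `c` at `y`, and `v - c • id` is then
monotone on either side of `y`. -/
lemma exists_slope_of_concaveOn_Ioo {a b : ℝ} {v : ℝ → ℝ} (hv : ConcaveOn ℝ (Ioo a b) v)
    {y : ℝ} (hy : y ∈ Ioo a b) :
    ∃ c : ℝ, (∀ s z, y ≤ s → s ≤ z → z < b → v z - v s ≤ c * (z - s)) ∧
      (∀ x s, a < x → x ≤ s → s ≤ y → c * (s - x) ≤ v s - v x) := by
  obtain ⟨x₀, hx₀⟩ := exists_between hy.1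
  obtain ⟨z₀, hz₀⟩ := exists_between hy.2
  obtain ⟨c, hc1, hc2⟩ := exists_between_of_forall_le
    (s := (fun z => (v z - v y) / (z - y)) '' Ioo y b)
    (t := (fun x => (v y - v x) / (y - x)) '' Ioo a y)
    ⟨_, mem_image_of_mem _ hz₀⟩ ⟨_, mem_image_of_mem _ hx₀⟩ (by
      rintro _ ⟨z, hz, rfl⟩ _ ⟨x, hx, rfl⟩
      exact hv.slope_anti_adjacent ⟨hx.1, hx.2.trans hy.2⟩ ⟨hy.1.trans hz.1, hz.2⟩ hx.2 hz.1)
  refine ⟨c, fun s z hys hsz hzb => ?_, fun x s hax hxs hsy => ?_⟩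
  · rcases hsz.eq_or_lt with rfl | hsz
    · simp
    rw [← div_le_iff₀ (sub_pos.2 hsz)]
    rcases hys.eq_or_lt with rfl | hys
    · exact hc1 ⟨z, ⟨hsz, hzb⟩, rfl⟩
    · exact (hv.slope_anti_adjacent hy ⟨hy.1.trans (hys.trans hsz), hzb⟩ hys hsz).trans
        (hc1 ⟨s, ⟨hys, hsz.trans hzb⟩, rfl⟩)
  · rcases hxs.eq_or_lt with rfl | hxs
    · simp
    rw [← le_div_iff₀ (sub_pos.2 hxs)]
    rcases hsy.eq_or_lt with rfl | hsy
    · exact hc2 ⟨x, ⟨hax, hxs⟩, rfl⟩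
    · exact (hc2 ⟨s, ⟨hax.trans hxs, hsy⟩, rfl⟩).trans
        (hv.slope_anti_adjacent ⟨hax, hxs.trans (hsy.trans hy.2)⟩ hy hxs hsy)

/-- If `log f - c • id` is decreasing and `f` is the derivative of `F`, then `f - c * F` has a
smaller value at the right endpoint than at the left one. The comparison function is an exponential
with rate `c`, anchored at the endpoint that makes it a lower bound (`c ≥ 0`) or an upper bound
(`c ≤ 0`) of `f`. -/
lemma sub_le_mul_sub_of_log_le {y z : ℝ} (hyz : y ≤ z) {c : ℝ} {F f : ℝ → ℝ}
    (hF : ∀ s ∈ Icc y z, HasDerivAt F (f s) s) (hf : ∀ s ∈ Icc y z, 0 < f s)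
    (hc : ∀ s t, y ≤ s → s ≤ t → t ≤ z → Real.log (f t) - Real.log (f s) ≤ c * (t - s)) :
    f z - f y ≤ c * (F z - F y) := by
  have hexp : ∀ s t, y ≤ s → s ≤ t → t ≤ z → f t ≤ f s * Real.exp (c * (t - s)) := by
    intro s t hs hst ht
    have h1 := hf s ⟨hs, hst.trans ht⟩
    calc f t = Real.exp (Real.log (f t)) := (Real.exp_log (hf t ⟨hs.trans hst, ht⟩)).symm
      _ ≤ Real.exp (Real.log (f s) + c * (t - s)) :=
        Real.exp_le_exp.2 (by linarith [hc s t hs hst ht])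
      _ = _ := by rw [Real.exp_add, Real.exp_log h1]
  have hFc : ContinuousOn F (Icc y z) := fun s hs => (hF s hs).continuousAt.continuousWithinAt
  rcases le_total 0 c with h0 | h0
  · have hd : ∀ s ∈ Icc y z, HasDerivAt (fun s => c * F s - f z * Real.exp (c * (s - z)))
        (c * f s - f z * (Real.exp (c * (s - z)) * c)) s := by
      intro s hs
      refine ((hF s hs).const_mul c).sub (HasDerivAt.const_mul _ ?_)
      simpa using (((hasDerivAt_id s).sub_const z).const_mul c).exp
    have hmono : MonotoneOn (fun s => c * F s - f z * Real.exp (c * (s - z))) (Icc y z) := by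
      refine monotoneOn_of_deriv_nonneg (convex_Icc _ _)
        (fun s hs => (hd s hs).continuousAt.continuousWithinAt)
        (fun s hs => (hd s (interior_subset hs)).differentiableAt.differentiableWithinAt)
        fun s hs => ?_
      have hs' := interior_subset hs
      rw [(hd s hs').deriv]
      have h1 := hexp s z hs'.1 hs'.2 le_rfl
      have h2 : f z * Real.exp (c * (s - z)) ≤ f s := by
        calc f z * Real.exp (c * (s - z))
            ≤ f s * Real.exp (c * (z - s)) * Real.exp (c * (s - z)) := by gcongr
          _ = f s := by rw [mul_assoc, ← Real.exp_add]; ring_nf; simp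
      nlinarith
    have h1 := hmono (left_mem_Icc.2 hyz) (right_mem_Icc.2 hyz) hyz
    have h2 : f z * Real.exp (c * (y - z)) ≤ f y := by
      calc f z * Real.exp (c * (y - z))
          ≤ f y * Real.exp (c * (z - y)) * Real.exp (c * (y - z)) := by
            gcongr; exact hexp y z le_rfl hyz le_rfl
        _ = f y := by rw [mul_assoc, ← Real.exp_add]; ring_nf; simp
    simp only [sub_self, mul_zero, Real.exp_zero, mul_one] at h1
    linarith
  · have hd : ∀ s ∈ Icc y z, HasDerivAt (fun s => c * F s - f y * Real.exp (c * (s - y)))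
        (c * f s - f y * (Real.exp (c * (s - y)) * c)) s := by
      intro s hs
      refine ((hF s hs).const_mul c).sub (HasDerivAt.const_mul _ ?_)
      simpa using (((hasDerivAt_id s).sub_const y).const_mul c).exp
    have hmono : MonotoneOn (fun s => c * F s - f y * Real.exp (c * (s - y))) (Icc y z) := by
      refine monotoneOn_of_deriv_nonneg (convex_Icc _ _)
        (fun s hs => (hd s hs).continuousAt.continuousWithinAt)
        (fun s hs => (hd s (interior_subset hs)).differentiableAt.differentiableWithinAt)
        fun s hs => ?_
      have hs' := interior_subset hs
      rw [(hd s hs').deriv]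
      have h1 := hexp y s le_rfl hs'.1 hs'.2
      nlinarith
    have h1 := hmono (left_mem_Icc.2 hyz) (right_mem_Icc.2 hyz) hyz
    have h2 := hexp y z le_rfl hyz le_rfl
    simp only [sub_self, mul_zero, Real.exp_zero, mul_one] at h1
    linarith

/-- A log-concave density is a concave function of its distribution function. -/
lemma three_point_of_logConcave {a b : ℝ} {F f : ℝ → ℝ}
    (hF : ∀ s ∈ Ioo a b, HasDerivAt F (f s) s) (hf : ∀ s ∈ Ioo a b, 0 < f s)
    (hlog : ConcaveOn ℝ (Ioo a b) fun s => Real.log (f s)) {x y z : ℝ} (hx : a < x)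
    (hxy : x ≤ y) (hyz : y ≤ z) (hz : z < b) (hFxy : F x ≤ F y) (hFyz : F y ≤ F z) :
    f x * (F z - F y) + f z * (F y - F x) ≤ f y * (F z - F x) := by
  obtain ⟨c, hc1, hc2⟩ := exists_slope_of_concaveOn_Ioo hlog (y := y)
    ⟨hx.trans_le hxy, hyz.trans_lt hz⟩
  have h1 : f z - f y ≤ c * (F z - F y) :=
    sub_le_mul_sub_of_log_le hyz
      (fun s hs => hF s ⟨(hx.trans_le hxy).trans_le hs.1, hs.2.trans_lt hz⟩)
      (fun s hs => hf s ⟨(hx.trans_le hxy).trans_le hs.1, hs.2.trans_lt hz⟩)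
      fun s t hs hst ht => hc1 s t hs hst (ht.trans_lt hz)
  have hI : ∀ s ∈ Icc (-y) (-x), -s ∈ Ioo a b := fun s hs =>
    ⟨by linarith [hs.2], by linarith [hs.1]⟩
  have h2 := sub_le_mul_sub_of_log_le (y := -y) (z := -x) (c := -c) (by linarith)
    (F := fun s => - F (-s)) (f := fun s => f (-s))
    (fun s hs => by
      refine ((hF (-s) (hI s hs)).comp s (hasDerivAt_neg s)).neg.congr_deriv ?_
      simp)
    (fun s hs => hf (-s) (hI s hs))
    (fun s t hs hst ht => by
      have := hc2 (-t) (-s) (by linarith) (by linarith) (by linarith)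
      linarith)
  simp only [neg_neg] at h2
  nlinarith [mul_le_mul_of_nonneg_right h1 (sub_nonneg.2 hFxy),
    mul_le_mul_of_nonneg_right h2 (sub_nonneg.2 hFyz)]

/-- The reciprocal of a positive concave function is convex, in three-point form. -/
lemma one_div_three_point {α β γ u w : ℝ} (hα : 0 < α) (hβ : 0 < β) (hγ : 0 < γ) (hu : 0 ≤ u)
    (hw : 0 ≤ w) (h : α * w + γ * u ≤ β * (w + u)) :
    (w + u) / β ≤ w / α + u / γ := by
  rw [div_add_div _ _ hα.ne' hγ.ne', div_le_div_iff₀ hβ (by positivity)]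
  rcases (add_nonneg hw hu).eq_or_lt with h0 | h0
  · rw [← h0]; simp; positivity
  -- Multiply by `w + u` and use `(wα + uγ)(wγ + uα) = (w + u)²αγ + wu(α - γ)²`.
  have h1 : (w * γ + α * u) * (α * w + γ * u) ≤ (w * γ + α * u) * (β * (w + u)) :=
    mul_le_mul_of_nonneg_left h (by positivity)
  have h2 : (w + u) * (w + u) * (α * γ) ≤ (w * γ + α * u) * (α * w + γ * u) := by
    nlinarith [mul_nonneg (mul_nonneg hw hu) (sq_nonneg (α - γ))]
  refine le_of_mul_le_mul_right ?_ h0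
  nlinarith

/-- The upper bound: `1/f` is a convex function of `F`, so it lies below its chord `ℓ` over the
interval on which `1/6 - F(1-F)` is negative, and above `ℓ` outside of this interval. Hence
`1/6 - F(1-F)` may be compared with `(1/6 - F(1-F)) ℓ(F) f`, whose integral vanishes. -/
lemma integral_le_of_logConcave {a b : ℝ} (hab : a < b)
    {F f : ℝ → ℝ} (hFc : ContinuousOn F (Icc a b)) (hFa : F a = 0) (hFb : F b = 1)
    (hF : ∀ s ∈ Ioo a b, HasDerivAt F (f s) s) (hf : ∀ s ∈ Ioo a b, 0 < f s)
    (hlog : ConcaveOn ℝ (Ioo a b) fun s => Real.log (f s)) :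
    (∫ s in a..b, 2 * F s * (1 - F s)) ≤ (b - a) / 3 ∧
      ((∫ s in a..b, 2 * F s * (1 - F s)) = (b - a) / 3 →
        ∃ c > 0, ∀ s ∈ Ioo a b, c * (b - s) ≤ 1 - F s) := by
  have hmono := strictMonoOn_of_hasDerivAt_pos hFc hF hf
  obtain ⟨t₀, ht₀, ht₀2, ht₀6⟩ : ∃ t₀ : ℝ, 0 < t₀ ∧ t₀ < 1 / 2 ∧ t₀ * (1 - t₀) = 1 / 6 := by
    have hs : Real.sqrt (1 / 12) ^ 2 = 1 / 12 := Real.sq_sqrt (by norm_num)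
    have hs0 : 0 < Real.sqrt (1 / 12) := Real.sqrt_pos.2 (by norm_num)
    refine ⟨1 / 2 - Real.sqrt (1 / 12), ?_, by linarith, by nlinarith⟩
    nlinarith
  obtain ⟨s₁, hs₁, hFs₁⟩ : ∃ s ∈ Ioo a b, F s = t₀ :=
    intermediate_value_Ioo hab.le hFc ⟨by rw [hFa]; linarith, by rw [hFb]; linarith⟩
  obtain ⟨s₂, hs₂, hFs₂⟩ : ∃ s ∈ Ioo a b, F s = 1 - t₀ :=
    intermediate_value_Ioo hab.le hFc ⟨by rw [hFa]; linarith, by rw [hFb]; linarith⟩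
  have hlt : ∀ {x y}, x ∈ Ioo a b → y ∈ Ioo a b → (F x < F y ↔ x < y) := fun hx hy =>
    hmono.lt_iff_lt (Ioo_subset_Icc_self hx) (Ioo_subset_Icc_self hy)
  have hle : ∀ {x y}, x ∈ Ioo a b → y ∈ Ioo a b → x ≤ y → F x ≤ F y := fun hx hy h =>
    hmono.monotoneOn (Ioo_subset_Icc_self hx) (Ioo_subset_Icc_self hy) h
  have hs₁₂ : s₁ < s₂ := (hlt hs₁ hs₂).1 (by linarith)
  set α := 1 / f s₁ with hα
  set β := 1 / f s₂ with hβ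
  set w := 1 - 2 * t₀ with hw
  have hw0 : 0 < w := by linarith
  have hf1 := hf s₁ hs₁
  have hf2 := hf s₂ hs₂
  set A := (α + β) / 2 with hA
  set B := (β - α) / w with hB
  set ℓ : ℝ → ℝ := fun t => A + B * (t - 1 / 2) with hℓ
  have hℓw : ∀ t, ℓ t * w = α * (1 - t₀ - t) + β * (t - t₀) := by
    intro t
    simp only [hℓ, hA, hB, add_mul]
    rw [mul_right_comm, div_mul_cancel₀ _ hw0.ne']
    simp only [hw]; ring
  have key : ∀ {x y z : ℝ}, x ∈ Ioo a b → y ∈ Ioo a b → z ∈ Ioo a b → x ≤ y → y ≤ z →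
      (F z - F x) / f y ≤ (F z - F y) / f x + (F y - F x) / f z := by
    intro x y z hx hy hz hxy hyz
    have h := three_point_of_logConcave hF hf hlog hx.1 hxy hyz hz.2 (hle hx hy hxy)
      (hle hy hz hyz)
    have := one_div_three_point (hf x hx) (hf y hy) (hf z hz) (u := F y - F x) (w := F z - F y)
      (sub_nonneg.2 (hle hx hy hxy)) (sub_nonneg.2 (hle hy hz hyz)) (by linarith)
    simpa using this
  have hsign : ∀ s ∈ Ioo a b, (1 / 6 - F s * (1 - F s)) * ℓ (F s) * f s ≤
      1 / 6 - F s * (1 - F s) := by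
    intro s hs
    have hfs := hf s hs
    have hfac : 1 / 6 - F s * (1 - F s) = (F s - t₀) * (F s - (1 - t₀)) := by
      rw [← ht₀6]; ring
    have hout : ℓ (F s) * w ≤ w / f s → ℓ (F s) * f s ≤ 1 := by
      intro h
      rw [le_div_iff₀ hfs] at h
      nlinarith
    have hin : w / f s ≤ ℓ (F s) * w → 1 ≤ ℓ (F s) * f s := by
      intro h
      rw [div_le_iff₀ hfs] at h
      nlinarith
    rcases le_total s s₁ with h1 | h1
    · have hk := key hs hs₁ hs₂ h1 hs₁₂.le
      have hF1 := hle hs hs₁ h1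
      rw [hFs₁, hFs₂] at hk
      have : ℓ (F s) * f s ≤ 1 := by
        refine hout ?_
        rw [hℓw, hα, hβ]
        have e : w / f s = (1 - t₀ - t₀) / f s := by rw [hw]; ring
        rw [e, one_div_mul_eq_div, one_div_mul_eq_div]
        have : (F s - t₀) / f s₂ = - ((t₀ - F s) / f s₂) := by ring
        linarith
      have h0 : 0 ≤ 1 / 6 - F s * (1 - F s) := by
        rw [hfac]; exact mul_nonneg_of_nonpos_of_nonpos (by linarith) (by linarith)
      nlinarith
    · have hF1 := hle hs₁ hs h1
      rcases le_total s s₂ with h2 | h2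
      · have hF2 := hle hs hs₂ h2
        have hk := key hs₁ hs hs₂ h1 h2
        rw [hFs₁, hFs₂] at hk
        have : 1 ≤ ℓ (F s) * f s := by
          refine hin ?_
          rw [hℓw, hα, hβ]
          have e : w / f s = (1 - t₀ - t₀) / f s := by rw [hw]; ring
          rw [e, one_div_mul_eq_div, one_div_mul_eq_div]
          linarith
        have h0 : 1 / 6 - F s * (1 - F s) ≤ 0 := by
          rw [hfac]; exact mul_nonpos_of_nonneg_of_nonpos (by linarith) (by linarith)
        nlinarith
      · have hF2 := hle hs₂ hs h2
        have hk := key hs₁ hs₂ hs hs₁₂.le h2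
        rw [hFs₁, hFs₂] at hk
        have : ℓ (F s) * f s ≤ 1 := by
          refine hout ?_
          rw [hℓw, hα, hβ]
          have e : w / f s = (1 - t₀ - t₀) / f s := by rw [hw]; ring
          rw [e, one_div_mul_eq_div, one_div_mul_eq_div]
          have : (1 - t₀ - F s) / f s₁ = - ((F s - (1 - t₀)) / f s₁) := by ring
          linarith
        have h0 : 0 ≤ 1 / 6 - F s * (1 - F s) := by
          rw [hfac]; exact mul_nonneg (by linarith) (by linarith)
        nlinarith
  set Q : ℝ → ℝ := fun t => A * (t * (1 - t) * (1 - 2 * t) / 6) + B * ((1 / 6 - t * (1 - t)) ^ 2 / 4)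
    with hQ
  have hQd : ∀ t, HasDerivAt Q ((1 / 6 - t * (1 - t)) * ℓ t) t := by
    intro t
    have h1 : HasDerivAt (fun t : ℝ => t * (1 - t)) (1 - 2 * t) t := by
      have := (hasDerivAt_id t).mul ((hasDerivAt_id t).const_sub 1)
      refine this.congr_deriv ?_
      simp only [id]; ring
    have h2 : HasDerivAt (fun t : ℝ => 1 - 2 * t) (-2) t := by
      have := ((hasDerivAt_id t).const_mul 2).const_sub 1
      refine this.congr_deriv ?_
      simp
    have h3 := (((h1.mul h2).div_const 6).const_mul A).add
      ((((h1.const_sub (1 / 6)).pow 2).div_const 4).const_mul B)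
    refine h3.congr_deriv ?_
    simp only [hℓ]
    push_cast
    ring
  have hQc : Continuous Q := by fun_prop
  have hRd : ∀ s ∈ Ioo a b, HasDerivAt (fun s => Q (F s))
      ((1 / 6 - F s * (1 - F s)) * ℓ (F s) * f s) s := fun s hs =>
    (hQd (F s)).comp s (hF s hs)
  obtain ⟨hmain, heq⟩ := sub_le_integral_and_eq hab (hQc.comp_continuousOn hFc)
    (φ := fun s => 1 / 6 - F s * (1 - F s)) (by fun_prop) hRd hsign
  have hint : (∫ s in a..b, (1 / 6 - F s * (1 - F s))) =
      (b - a) / 6 - (∫ s in a..b, 2 * F s * (1 - F s)) / 2 := by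
    rw [intervalIntegral.integral_sub, intervalIntegral.integral_const, smul_eq_mul,
      ← intervalIntegral.integral_div]
    · congr 1
      · ring
      · congr 1; ext s; ring
    · exact intervalIntegrable_const
    · exact ContinuousOn.intervalIntegrable_of_Icc hab.le (by fun_prop)
  have hQ01 : Q 1 - Q 0 = 0 := by simp [hQ]
  simp only [Function.comp_apply, hFa, hFb, hQ01, hint] at hmain heq
  refine ⟨by linarith, fun h => ?_⟩
  have heq' := heq (by linarith)
  -- In case of equality `f = 1 / ℓ(F)`, which is bounded below since `ℓ` is bounded on `[0, 1]`.
  set M := |A| + |B| + 1 with hM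
  have hM0 : 0 < M := by positivity
  have hfM : ∀ s ∈ Ioo a b, 1 / M ≤ f s := by
    intro s hs
    have hfs := hf s hs
    have h1 : ℓ (F s) * f s = 1 := by
      by_cases hg : 1 / 6 - F s * (1 - F s) = 0
      · have hfac : (F s - t₀) * (F s - (1 - t₀)) = 0 := by rw [← hg, ← ht₀6]; ring
        have h3 := hℓw (F s)
        rcases mul_eq_zero.1 hfac with h2 | h2
        · have : s = s₁ := hmono.injOn (Ioo_subset_Icc_self hs) (Ioo_subset_Icc_self hs₁)
            (by linarith)
          subst this
          rw [hFs₁] at h3 ⊢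
          have : ℓ t₀ = α := mul_right_cancel₀ hw0.ne' (by rw [h3, hw]; ring)
          rw [this, hα, one_div_mul_cancel hfs.ne']
        · have : s = s₂ := hmono.injOn (Ioo_subset_Icc_self hs) (Ioo_subset_Icc_self hs₂)
            (by linarith)
          subst this
          rw [hFs₂] at h3 ⊢
          have : ℓ (1 - t₀) = β := mul_right_cancel₀ hw0.ne' (by rw [h3, hw]; ring)
          rw [this, hβ, one_div_mul_cancel hfs.ne']
      · have := heq' s hs
        rw [mul_assoc] at this
        exact mul_left_cancel₀ hg (by rw [this, mul_one])
    have h2 : ℓ (F s) ≤ M := by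
      have hF0 : 0 ≤ F s := by
        rw [← hFa]
        exact hmono.monotoneOn (left_mem_Icc.2 hab.le) (Ioo_subset_Icc_self hs) hs.1.le
      have hF1 : F s ≤ 1 := by
        rw [← hFb]
        exact hmono.monotoneOn (Ioo_subset_Icc_self hs) (right_mem_Icc.2 hab.le) hs.2.le
      have h3 : B * (F s - 1 / 2) ≤ |B| := by
        calc B * (F s - 1 / 2) ≤ |B * (F s - 1 / 2)| := le_abs_self _
          _ = |B| * |F s - 1 / 2| := abs_mul _ _
          _ ≤ |B| * 1 := by
            gcongr; rw [abs_le]; constructor <;> linarith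
          _ = |B| := mul_one _
      have := le_abs_self A
      simp only [hℓ]; linarith
    rw [div_le_iff₀ hM0, ← h1, mul_comm]
    gcongr
  refine ⟨1 / M, by positivity, fun s hs => ?_⟩
  obtain ⟨c, hc, hcs⟩ := exists_hasDerivAt_eq_slope F f hs.2
    (hFc.mono (Icc_subset_Icc_left hs.1.le)) fun x hx => hF x ⟨hs.1.trans hx.1, hx.2⟩
  have h1 := hfM c ⟨hs.1.trans hc.1, hc.2⟩
  rw [hcs, hFb, le_div_iff₀ (by linarith [hs.2])] at h1
  exact h1

/-! ### Averages over the sphere -/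

lemma exists_isometry_map_eq {d : ℕ} (x y : EuclideanSpace ℝ (Fin d)) (h : ‖x‖ = ‖y‖) :
    ∃ L : EuclideanSpace ℝ (Fin d) ≃ₗᵢ[ℝ] EuclideanSpace ℝ (Fin d), L x = y :=
  ⟨_, Submodule.reflection_sub h⟩

/-- Integration in polar coordinates of a product of an angular and a radial function. -/
lemma integral_polar {E : Type*} [NormedAddCommGroup E] [NormedSpace ℝ E] [MeasurableSpace E]
    [BorelSpace E] [FiniteDimensional ℝ E] [Nontrivial E] (μ : Measure E) [μ.IsAddHaarMeasure]
    (g : E → ℝ) (h : ℝ → ℝ) :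
    ∫ x, g (‖x‖⁻¹ • x) * h ‖x‖ ∂μ = (∫ u : Metric.sphere (0 : E) 1, g u ∂μ.toSphere) *
      ∫ r in Ioi (0 : ℝ), r ^ (Module.finrank ℝ E - 1) * h r :=
  calc
    ∫ x, g (‖x‖⁻¹ • x) * h ‖x‖ ∂μ
        = ∫ x : ({(0)}ᶜ : Set E), g (‖x.1‖⁻¹ • x.1) * h (‖x.1‖) ∂(μ.comap (↑)) := by
      rw [integral_subtype_comap (measurableSet_singleton _).compl
        fun x => g (‖x‖⁻¹ • x) * h (‖x‖), restrict_compl_singleton]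
    _ = ∫ x, g x.1 * h x.2 ∂μ.toSphere.prod (.volumeIoiPow (Module.finrank ℝ E - 1)) := by
      simpa using μ.measurePreserving_homeomorphUnitSphereProd.integral_comp
        (Homeomorph.measurableEmbedding _)
        (fun z : Metric.sphere (0 : E) 1 × Ioi (0 : ℝ) => g z.1 * h z.2)
    _ = (∫ u : Metric.sphere (0 : E) 1, g u ∂μ.toSphere) *
        ∫ x : Ioi (0 : ℝ), h x ∂.volumeIoiPow (Module.finrank ℝ E - 1) :=
      integral_prod_mul (fun u : Metric.sphere (0 : E) 1 => g u) (fun r : Ioi (0 : ℝ) => h r)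
    _ = _ := by
      congr 1
      simp only [Measure.volumeIoiPow, ENNReal.ofReal]
      rw [integral_withDensity_eq_integral_smul,
        integral_subtype_comap measurableSet_Ioi
          fun a => Real.toNNReal (a ^ (Module.finrank ℝ E - 1)) • h a,
        setIntegral_congr_fun measurableSet_Ioi fun x hx => ?_]
      · rw [NNReal.smul_def, Real.coe_toNNReal _ (pow_nonneg (le_of_lt hx) _), smul_eq_mul]
      · exact (measurable_subtype_coe.pow_const _).real_toNNReal

lemma integral_Ioi_pow_mul_exp_neg_sq (k : ℕ) :
    ∫ r in Ioi (0 : ℝ), r ^ k * Real.exp (-r ^ 2) = Real.Gamma (((k : ℝ) + 1) / 2) / 2 := by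
  have := integral_rpow_mul_exp_neg_rpow (p := 2) (q := k) two_pos
    (by have : (0 : ℝ) ≤ k := k.cast_nonneg
        linarith)
  rw [div_eq_inv_mul, inv_eq_one_div, ← this]
  refine setIntegral_congr_fun measurableSet_Ioi fun r _ => ?_
  simp

lemma integral_abs_mul_exp_neg_sq : ∫ t : ℝ, |t| * Real.exp (-t ^ 2) = 1 := by
  have h := integral_comp_abs (f := fun t : ℝ => t * Real.exp (-t ^ 2))
  simp only [sq_abs] at h
  have h1 := integral_Ioi_pow_mul_exp_neg_sq 1
  simp only [pow_one] at h1
  rw [h, h1]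
  norm_num

lemma integral_exp_neg_sq : ∫ t : ℝ, Real.exp (-t ^ 2) = Real.sqrt Real.pi := by
  simpa using integral_gaussian 1

lemma integral_euclidean_prod {d : ℕ} (φ : Fin d → ℝ → ℝ) :
    ∫ y : EuclideanSpace ℝ (Fin d), ∏ i, φ i (y i) = ∏ i, ∫ t, φ i t := by
  rw [← integral_fintype_prod_volume_eq_prod]
  exact (PiLp.volume_preserving_ofLp (Fin d)).integral_comp
    (MeasurableEquiv.toLp 2 (Fin d → ℝ)).symm.measurableEmbedding (fun y => ∏ i, φ i (y i))

lemma exp_neg_norm_sq {d : ℕ} (y : EuclideanSpace ℝ (Fin d)) :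
    Real.exp (-‖y‖ ^ 2) = ∏ i, Real.exp (-(y i) ^ 2) := by
  rw [EuclideanSpace.real_norm_sq_eq, ← Finset.sum_neg_distrib, Real.exp_sum]

lemma integral_exp_neg_norm_sq (d : ℕ) :
    ∫ y : EuclideanSpace ℝ (Fin d), Real.exp (-‖y‖ ^ 2) = Real.sqrt Real.pi ^ d := by
  simp_rw [exp_neg_norm_sq]
  rw [integral_euclidean_prod fun _ t => Real.exp (-t ^ 2)]
  simp [integral_exp_neg_sq]

lemma integral_abs_inner_mul_exp (n : ℕ) (x : EuclideanSpace ℝ (Fin (n + 1))) :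
    ∫ y : EuclideanSpace ℝ (Fin (n + 1)), |inner ℝ x y| * Real.exp (-‖y‖ ^ 2) =
      ‖x‖ * Real.sqrt Real.pi ^ n := by
  obtain ⟨L, hL⟩ := exists_isometry_map_eq x (‖x‖ • EuclideanSpace.single 0 1) (by simp [norm_smul])
  have h1 : ∀ y, |inner ℝ x y| * Real.exp (-‖y‖ ^ 2) =
      ‖x‖ * (|(L y) 0| * Real.exp (-‖L y‖ ^ 2)) := by
    intro y
    rw [← L.inner_map_map x y, hL, L.norm_map, inner_smul_left, EuclideanSpace.inner_single_left]
    simp [abs_mul, mul_assoc]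
  simp_rw [h1]
  rw [integral_const_mul, L.measurePreserving.integral_comp
    L.toMeasurableEquiv.measurableEmbedding (fun y => |y 0| * Real.exp (-‖y‖ ^ 2))]
  congr 1
  have h2 : ∀ y : EuclideanSpace ℝ (Fin (n + 1)), |y 0| * Real.exp (-‖y‖ ^ 2) =
      ∏ i, (if i = 0 then |y i| else 1) * Real.exp (-(y i) ^ 2) := by
    intro y
    rw [exp_neg_norm_sq, Finset.prod_mul_distrib, Finset.prod_ite_eq' Finset.univ (0 : Fin (n + 1))]
    simp
  simp_rw [h2]
  rw [integral_euclidean_prod fun i t => (if i = 0 then |t| else 1) * Real.exp (-t ^ 2),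
    Fin.prod_univ_succ]
  simp [integral_exp_neg_sq, integral_abs_mul_exp_neg_sq, Fin.succ_ne_zero]

/-- The surface measure of the unit sphere. -/
noncomputable abbrev sphereMeasure (d : ℕ) :
    Measure (Metric.sphere (0 : EuclideanSpace ℝ (Fin d)) 1) :=
  (volume : Measure (EuclideanSpace ℝ (Fin d))).toSphere

lemma sphereMeasure_real_univ (n : ℕ) : (sphereMeasure (n + 1)).real univ *
    (Real.Gamma (((n + 1 : ℕ) : ℝ) / 2) / 2) = Real.sqrt Real.pi ^ (n + 1) := by
  have := integral_polar (volume : Measure (EuclideanSpace ℝ (Fin (n + 1)))) (fun _ => 1)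
    (fun r => Real.exp (-r ^ 2))
  simp only [one_mul, integral_exp_neg_norm_sq, finrank_euclideanSpace_fin,
    Nat.add_sub_cancel, integral_Ioi_pow_mul_exp_neg_sq, integral_const, smul_eq_mul, mul_one]
    at this
  rw [this]; push_cast; rfl

lemma integral_sphere_abs_inner (n : ℕ) (x : EuclideanSpace ℝ (Fin (n + 1))) :
    (∫ u, |inner ℝ x (u : EuclideanSpace ℝ (Fin (n + 1)))| ∂sphereMeasure (n + 1)) *
      (Real.Gamma ((((n + 1 : ℕ) : ℝ) + 1) / 2) / 2) = ‖x‖ * Real.sqrt Real.pi ^ n := by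
  have := integral_polar (volume : Measure (EuclideanSpace ℝ (Fin (n + 1))))
    (fun u => |inner ℝ x u|) (fun r => r * Real.exp (-r ^ 2))
  have h1 : ∀ y : EuclideanSpace ℝ (Fin (n + 1)), |inner ℝ x (‖y‖⁻¹ • y)| *
      (‖y‖ * Real.exp (-‖y‖ ^ 2)) = |inner ℝ x y| * Real.exp (-‖y‖ ^ 2) := by
    intro y
    rcases eq_or_ne y 0 with rfl | hy
    · simp
    have : ‖y‖ ≠ 0 := norm_ne_zero_iff.2 hy
    rw [inner_smul_right, abs_mul, abs_of_nonneg (by positivity : 0 ≤ ‖y‖⁻¹)]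
    field_simp
  simp_rw [h1, integral_abs_inner_mul_exp] at this
  rw [this]
  congr 1
  rw [← integral_Ioi_pow_mul_exp_neg_sq]
  refine setIntegral_congr_fun measurableSet_Ioi fun r _ => ?_
  simp only [finrank_euclideanSpace_fin, Nat.add_sub_cancel, pow_succ]
  ring

/-- The constant that relates `firstIntrinsicVolume` to `meanWidth`. -/
noncomputable def widthConst (d : ℕ) : ℝ :=
  Real.sqrt Real.pi * (Real.Gamma (((d : ℝ) + 1) / 2) / Real.Gamma ((d : ℝ) / 2))

lemma widthConst_pos (n : ℕ) : 0 < widthConst (n + 1) := by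
  have h1 : 0 < Real.Gamma ((((n + 1 : ℕ) : ℝ) + 1) / 2) := Real.Gamma_pos_of_pos (by positivity)
  have h2 : 0 < Real.Gamma (((n + 1 : ℕ) : ℝ) / 2) := Real.Gamma_pos_of_pos (by positivity)
  unfold widthConst
  positivity

/-- The Euclidean norm is a multiple of the spherical average of the lengths of projections. -/
lemma widthConst_mul_average_abs_inner (n : ℕ) (x : EuclideanSpace ℝ (Fin (n + 1))) :
    widthConst (n + 1) *
      (⨍ u, |inner ℝ x (u : EuclideanSpace ℝ (Fin (n + 1)))| ∂sphereMeasure (n + 1)) = ‖x‖ := by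
  have h1 : 0 < Real.Gamma ((((n + 1 : ℕ) : ℝ) + 1) / 2) := Real.Gamma_pos_of_pos (by positivity)
  have h2 : 0 < Real.Gamma (((n + 1 : ℕ) : ℝ) / 2) := Real.Gamma_pos_of_pos (by positivity)
  have hpi : 0 < Real.sqrt Real.pi := Real.sqrt_pos.2 Real.pi_pos
  have hu := sphereMeasure_real_univ n
  have hi := integral_sphere_abs_inner n x
  have hσ : (sphereMeasure (n + 1)).real univ ≠ 0 := by
    intro h0
    rw [h0, zero_mul] at hu
    exact (pow_pos hpi _).ne hu
  rw [average_eq, smul_eq_mul, widthConst]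
  generalize (∫ u, |inner ℝ x (u : EuclideanSpace ℝ (Fin (n + 1)))| ∂sphereMeasure (n + 1)) = I at *
  generalize (sphereMeasure (n + 1)).real univ = σ at *
  field_simp
  rw [pow_succ] at hu
  have h3 : I * Real.Gamma ((((n + 1 : ℕ) : ℝ) + 1) / 2) * Real.sqrt Real.pi =
      ‖x‖ * (σ * Real.Gamma (((n + 1 : ℕ) : ℝ) / 2)) := by
    linear_combination 2 * Real.sqrt Real.pi * hi - 2 * ‖x‖ * hu
  linear_combination h3

/-! ### Sections of a convex body -/

/-- Brunn–Minkowski in multiplicative form for a family of sets that is concave with respect to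
inclusion of Minkowski combinations. -/
lemma concaveOn_log_measure {X : Type*} [NormedAddCommGroup X] [NormedSpace ℝ X] [MeasureSpace X]
    (hX : PrekopaLeindler X) {I : Set ℝ} (hI : Convex ℝ I) {T : ℝ → Set X} {V : ℝ} (hV : 0 < V)
    (hmeas : ∀ s, MeasurableSet (T s)) (hfin : ∀ s, volume (T s) ≠ ⊤)
    (hpos : ∀ s ∈ I, 0 < volume.real (T s))
    (hT : ∀ s t p q : ℝ, 0 < p → 0 < q → p + q = 1 → ∀ x ∈ T s, ∀ y ∈ T t,
      p • x + q • y ∈ T (p * s + q * t)) :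
    ConcaveOn ℝ I fun s => Real.log (volume.real (T s) / V) := by
  refine concaveOn_iff_forall_pos.2 ⟨hI, fun s hs t ht p q hp hq hpq => ?_⟩
  have h := hX.measure_rpow_mul_le hp hq hpq (hmeas s) (hmeas t) (hmeas _)
    (hT s t p q hp hq hpq)
  have h2 := ENNReal.toReal_mono (hfin _) h
  rw [ENNReal.toReal_mul, ← ENNReal.toReal_rpow, ← ENNReal.toReal_rpow] at h2
  simp only [← measureReal_def] at h2
  have hs' := hpos s hs
  have ht' := hpos t ht
  have hst := hpos _ (hI hs ht hp.le hq.le hpq)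
  have h3 := Real.log_le_log (by positivity) h2
  rw [Real.log_mul (by positivity) (by positivity), Real.log_rpow hs', Real.log_rpow ht'] at h3
  simp only [smul_eq_mul] at hst ⊢
  rw [Real.log_div hs'.ne' hV.ne', Real.log_div ht'.ne' hV.ne', Real.log_div hst.ne' hV.ne']
  linear_combination h3 - Real.log V * hpq

/-- Brunn–Minkowski in additive form for a family of sets that is concave with respect to
inclusion of Minkowski combinations. -/
lemma concaveOn_measure_rpow {X : Type*} [NormedAddCommGroup X] [NormedSpace ℝ X]
    [MeasureSpace X] [BorelSpace X] [FiniteDimensional ℝ X]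
    [(volume : Measure X).IsAddHaarMeasure] (hX : PrekopaLeindler X) {d : ℕ} (hd : 0 < d)
    (hdX : Module.finrank ℝ X = d) {I : Set ℝ} (hI : Convex ℝ I) {T : ℝ → Set X} {V : ℝ}
    (hV : 0 < V) (hmeas : ∀ s, MeasurableSet (T s)) (hfin : ∀ s, volume (T s) ≠ ⊤)
    (hpos : ∀ s ∈ I, 0 < volume.real (T s))
    (hT : ∀ s t p q : ℝ, 0 < p → 0 < q → p + q = 1 → ∀ x ∈ T s, ∀ y ∈ T t,
      p • x + q • y ∈ T (p * s + q * t)) :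
    ConcaveOn ℝ I fun s => (volume.real (T s) / V) ^ (1 / d : ℝ) := by
  refine concaveOn_iff_forall_pos.2 ⟨hI, fun s hs t ht p q hp hq hpq => ?_⟩
  have h := hX.brunnMinkowski hd hdX hp hq (hmeas s) (hmeas t) (hmeas _) (hfin _) (hpos s hs)
    (hpos t ht) (hT s t p q hp hq hpq)
  simp only [smul_eq_mul]
  simp only [Real.div_rpow measureReal_nonneg hV.le]
  have hV' : 0 < V ^ (1 / d : ℝ) := Real.rpow_pos_of_pos hV _
  rw [← mul_div_assoc, ← mul_div_assoc, ← add_div]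
  gcongr

section Sections

variable {n : ℕ} {K : Set (ℝ × (Fin n → ℝ))}

/-- The `n`-dimensional volume of the section of `K` by the hyperplane with first coordinate `s`. -/
noncomputable def secVol (K : Set (ℝ × (Fin n → ℝ))) (s : ℝ) : ℝ :=
  volume.real {y | (s, y) ∈ K}

lemma isCompact_section (hK : IsCompact K) (s : ℝ) : IsCompact {y | (s, y) ∈ K} := by
  have : {y | (s, y) ∈ K} = Prod.snd '' (K ∩ Prod.fst ⁻¹' {s}) := by
    ext y
    simp only [mem_ofPred_eq, mem_image, mem_inter_iff, mem_preimage, mem_singleton_iff,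
      Prod.exists, exists_eq_right]
  rw [this]
  exact (hK.inter_right (isClosed_singleton.preimage continuous_fst)).image continuous_snd

lemma integrable_secVol (hK : IsCompact K) : Integrable (secVol K) := by
  have h := Measure.integrable_measure_prodMk_left (μ := (volume : Measure ℝ))
    (ν := (volume : Measure (Fin n → ℝ))) hK.measurableSet hK.measure_lt_top.ne
  exact h

lemma volume_real_inter_fst (hK : IsCompact K) {I : Set ℝ} (hI : MeasurableSet I) :
    volume.real (K ∩ Prod.fst ⁻¹' I) = ∫ t in I, secVol K t := by
  have hm : Measurable fun t => volume {y | (t, y) ∈ K} := measurable_measure_prodMk_left hK.measurableSet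
  simp only [secVol, measureReal_def]
  rw [integral_toReal hm.aemeasurable
    (.of_forall fun t => (isCompact_section hK t).measure_lt_top), ← lintegral_indicator hI,
    Measure.volume_eq_prod, Measure.prod_apply (hK.measurableSet.inter (measurable_fst hI))]
  congr 2
  ext t
  by_cases ht : t ∈ I
  · simp only [ht, indicator_of_mem]; congr 1; ext y; simp [ht]
  · have : Prod.mk t ⁻¹' (K ∩ Prod.fst ⁻¹' I) = ∅ := by
      ext y; simp [ht]
    simp [ht, this]

/-- A segment in the interior of `K` joins points on either side of the hyperplane at level `s`, so
the section there has interior points. -/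
lemma secVol_pos (hK : IsCompact K) (hKc : Convex ℝ K) (hKi : (interior K).Nonempty) {a b : ℝ}
    (hab : Prod.fst '' K = Icc a b) (hlt : a < b) : ∀ s ∈ Ioo a b, 0 < secVol K s := by
  intro s hs
  have hcl : K ⊆ closure (interior K) := by
    rw [hKc.closure_interior_eq_closure_of_nonempty_interior hKi]; exact subset_closure
  obtain ⟨p, hp, hpa⟩ : a ∈ Prod.fst '' K := by rw [hab]; exact left_mem_Icc.2 hlt.le
  obtain ⟨q, hq, hqb⟩ : b ∈ Prod.fst '' K := by rw [hab]; exact right_mem_Icc.2 hlt.le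
  obtain ⟨p', hp's, hp'⟩ := mem_closure_iff.1 (hcl hp) (Prod.fst ⁻¹' Iio s)
    (isOpen_Iio.preimage continuous_fst) (by simpa [hpa] using hs.1)
  obtain ⟨q', hq's, hq'⟩ := mem_closure_iff.1 (hcl hq) (Prod.fst ⁻¹' Ioi s)
    (isOpen_Ioi.preimage continuous_fst) (by simpa [hqb] using hs.2)
  have hconv : Convex ℝ (Prod.fst '' interior K) :=
    hKc.interior.linear_image (LinearMap.fst ℝ ℝ (Fin n → ℝ))
  obtain ⟨⟨_, y⟩, hz, rfl⟩ := hconv.ordConnected.out (mem_image_of_mem _ hp')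
    (mem_image_of_mem _ hq') ⟨le_of_lt hp's, le_of_lt hq's⟩
  have hopen : IsOpen {y' | ((‹ℝ›, y') : ℝ × (Fin n → ℝ)) ∈ interior K} :=
    isOpen_interior.preimage (by fun_prop)
  rw [secVol, measureReal_def]
  refine ENNReal.toReal_pos ?_ (isCompact_section hK _).measure_lt_top.ne
  refine (lt_of_lt_of_le (hopen.measure_pos volume ⟨y, hz⟩) (measure_mono ?_)).ne'
  exact fun y' hy' => interior_subset (s := K) hy'

lemma prekopaLeindler_prod_pi (n : ℕ) : PrekopaLeindler (ℝ × (Fin n → ℝ)) :=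
  prekopaLeindler_real.prod (prekopaLeindler_pi n)

/-- The distribution function of the first coordinate of a uniform random point of `K`. -/
noncomputable def fstCdf (K : Set (ℝ × (Fin n → ℝ))) (s : ℝ) : ℝ :=
  volume.real (K ∩ Prod.fst ⁻¹' Iic s) / volume.real K

lemma volume_real_pos {X : Type*} [TopologicalSpace X] [MeasureSpace X]
    [(volume : Measure X).IsOpenPosMeasure] [IsFiniteMeasureOnCompacts (volume : Measure X)]
    {K : Set X} (hK : IsCompact K) (hKi : (interior K).Nonempty) : 0 < volume.real K :=
  ENNReal.toReal_pos (lt_of_lt_of_le (isOpen_interior.measure_pos volume hKi)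
    (measure_mono interior_subset)).ne' hK.measure_lt_top.ne

lemma secVol_eq_zero {a b : ℝ} (hab : Prod.fst '' K = Icc a b) {s : ℝ} (hs : s ∉ Icc a b) :
    secVol K s = 0 := by
  have : {y | (s, y) ∈ K} = ∅ := by
    refine eq_empty_of_forall_notMem fun y hy => hs ?_
    rw [← hab]; exact ⟨(s, y), hy, rfl⟩
  simp [secVol, this]

lemma fstCdf_eq_integral (hK : IsCompact K) {a b : ℝ} (hab : Prod.fst '' K = Icc a b) {s : ℝ}
    (hs : a ≤ s) : fstCdf K s = (∫ t in a..s, secVol K t) / volume.real K := by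
  rw [fstCdf, volume_real_inter_fst hK measurableSet_Iic, intervalIntegral.integral_of_le hs,
    ← Iic_union_Ioc_eq_Iic hs, setIntegral_union (Iic_disjoint_Ioc le_rfl) measurableSet_Ioc
    (integrable_secVol hK).integrableOn (integrable_secVol hK).integrableOn]
  have : ∫ t in Iic a, secVol K t = 0 := by
    rw [integral_Iic_eq_integral_Iio]
    refine (setIntegral_congr_fun (g := fun _ => (0 : ℝ)) measurableSet_Iio fun t ht => ?_).trans
      (by simp)
    exact secVol_eq_zero hab fun h => absurd h.1 (not_le.2 ht)
  rw [this, zero_add]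

lemma one_sub_fstCdf (hK : IsCompact K) (hV : 0 < volume.real K) (s : ℝ) :
    1 - fstCdf K s = volume.real (K ∩ Prod.fst ⁻¹' Ioi s) / volume.real K := by
  have hm : MeasurableSet (Prod.fst ⁻¹' Iic s : Set (ℝ × (Fin n → ℝ))) :=
    measurable_fst measurableSet_Iic
  have h := measureReal_inter_add_sdiff (μ := volume) (s := K) hm hK.measure_lt_top.ne
  have hdiff : K \ Prod.fst ⁻¹' Iic s = K ∩ Prod.fst ⁻¹' Ioi s := by
    ext p; simp
  rw [hdiff] at h
  rw [fstCdf, eq_div_iff hV.ne', sub_mul, div_mul_cancel₀ _ hV.ne', one_mul]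
  linarith

/-- The analytic properties of the law of a linear functional of a uniform random point of a convex
body, with distribution function `F` and density `f` on its support `[a, b]`. -/
structure IsProjectionLaw (d : ℕ) (a b : ℝ) (F f : ℝ → ℝ) : Prop where
  lt : a < b
  continuousOn : ContinuousOn F (Icc a b)
  left : F a = 0
  right : F b = 1
  hasDerivAt : ∀ s ∈ Ioo a b, HasDerivAt F (f s) s
  pos : ∀ s ∈ Ioo a b, 0 < f s
  concaveOn_log : ConcaveOn ℝ (Ioo a b) fun s => Real.log (f s)
  concaveOn_rpow : ConcaveOn ℝ (Ioo a b) fun s => F s ^ (1 / d : ℝ)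
  concaveOn_one_sub_rpow : ConcaveOn ℝ (Ioo a b) fun s => (1 - F s) ^ (1 / d : ℝ)

lemma isProjectionLaw_fstCdf (hK : IsCompact K) (hKc : Convex ℝ K) (hKi : (interior K).Nonempty)
    {a b : ℝ} (hab : Prod.fst '' K = Icc a b) (hlt : a < b) :
    IsProjectionLaw (n + 1) a b (fstCdf K) fun s => secVol K s / volume.real K := by
  have hV := volume_real_pos hK hKi
  have hpos := secVol_pos hK hKc hKi hab hlt
  have hKfin := (hK.measure_lt_top (μ := volume)).ne
  have hint := integrable_secVol hK
  have hcombo : ∀ s t p q : ℝ, 0 < p → 0 < q → p + q = 1 → ∀ y, (s, y) ∈ K → ∀ z, (t, z) ∈ K →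
      (p * s + q * t, p • y + q • z) ∈ K := fun s t p q hp hq hpq y hy z hz =>
    hKc hy hz hp.le hq.le hpq
  have hlog : ConcaveOn ℝ (Ioo a b) fun s => Real.log (secVol K s / volume.real K) :=
    concaveOn_log_measure (prekopaLeindler_pi n) (convex_Ioo a b) hV
      (fun s => (isCompact_section hK s).measurableSet)
      (fun s => (isCompact_section hK s).measure_lt_top.ne) hpos
      fun s t p q hp hq hpq y hy z hz => hcombo s t p q hp hq hpq y hy z hz
  have hcont : ContinuousOn (secVol K) (Ioo a b) := by
    have h1 := (hlog.continuousOn isOpen_Ioo).rexp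
    have h2 : ContinuousOn (fun s => volume.real K *
      Real.exp (Real.log (secVol K s / volume.real K))) (Ioo a b) := continuousOn_const.mul h1
    refine h2.congr fun s hs => ?_
    simp only
    rw [Real.exp_log (div_pos (hpos s hs) hV), mul_div_cancel₀ _ hV.ne']
  have hderiv : ∀ s ∈ Ioo a b, HasDerivAt (fstCdf K) (secVol K s / volume.real K) s := by
    intro s hs
    have h1 := (intervalIntegral.integral_hasDerivAt_right (a := a) (b := s)
      hint.intervalIntegrable
      (hcont.stronglyMeasurableAtFilter isOpen_Ioo s hs)
      (hcont.continuousAt (isOpen_Ioo.mem_nhds hs))).div_const (volume.real K)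
    refine h1.congr_of_eventuallyEq ?_
    filter_upwards [Ioi_mem_nhds hs.1] with t ht using fstCdf_eq_integral hK hab (le_of_lt ht)
  have hFc : ContinuousOn (fstCdf K) (Icc a b) := by
    have h1 : Continuous fun s => (∫ t in a..s, secVol K t) / volume.real K :=
      (intervalIntegral.continuous_primitive (fun _ _ => hint.intervalIntegrable) a).div_const _
    exact h1.continuousOn.congr fun s hs => fstCdf_eq_integral hK hab hs.1
  have hFa : fstCdf K a = 0 := by simp [fstCdf_eq_integral hK hab le_rfl]
  have hFb : fstCdf K b = 1 := by
    rw [fstCdf, inter_eq_left.2, div_self hV.ne']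
    intro p hp
    have : p.1 ∈ Icc a b := by rw [← hab]; exact mem_image_of_mem _ hp
    exact this.2
  have hf : ∀ s ∈ Ioo a b, 0 < secVol K s / volume.real K := fun s hs => div_pos (hpos s hs) hV
  have hmono := strictMonoOn_of_hasDerivAt_pos hFc hderiv hf
  have : (volume : Measure (ℝ × (Fin n → ℝ))).IsAddHaarMeasure :=
    Measure.prod.instIsAddHaarMeasure volume volume
  have hfinrank : Module.finrank ℝ (ℝ × (Fin n → ℝ)) = n + 1 := by simp [add_comm]
  refine ⟨hlt, hFc, hFa, hFb, hderiv, hf, hlog, ?_, ?_⟩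
  · refine concaveOn_measure_rpow (prekopaLeindler_prod_pi n) n.succ_pos hfinrank (convex_Ioo a b) hV
      (T := fun s => K ∩ Prod.fst ⁻¹' Iic s)
      (fun s => hK.measurableSet.inter (measurable_fst measurableSet_Iic))
      (fun s => ne_top_of_le_ne_top hKfin (measure_mono inter_subset_left)) (fun s hs => ?_) ?_
    · have h1 := hmono (left_mem_Icc.2 hlt.le) (Ioo_subset_Icc_self hs) hs.1
      rw [hFa, fstCdf] at h1
      exact (div_pos_iff_of_pos_right hV).1 h1
    · intro s t p q hp hq hpq x hx y hy
      refine ⟨hKc hx.1 hy.1 hp.le hq.le hpq, ?_⟩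
      have h1 : x.1 ≤ s := hx.2
      have h2 : y.1 ≤ t := hy.2
      change p * x.1 + q * y.1 ≤ p * s + q * t
      gcongr
  · simp_rw [one_sub_fstCdf hK hV]
    refine concaveOn_measure_rpow (prekopaLeindler_prod_pi n) n.succ_pos hfinrank (convex_Ioo a b) hV
      (T := fun s => K ∩ Prod.fst ⁻¹' Ioi s)
      (fun s => hK.measurableSet.inter (measurable_fst measurableSet_Ioi))
      (fun s => ne_top_of_le_ne_top hKfin (measure_mono inter_subset_left)) (fun s hs => ?_) ?_
    · have h1 := hmono (Ioo_subset_Icc_self hs) (right_mem_Icc.2 hlt.le) hs.2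
      rw [hFb, ← sub_pos, one_sub_fstCdf hK hV] at h1
      exact (div_pos_iff_of_pos_right hV).1 h1
    · intro s t p q hp hq hpq x hx y hy
      refine ⟨hKc hx.1 hy.1 hp.le hq.le hpq, ?_⟩
      have h1 : s < x.1 := hx.2
      have h2 : t < y.1 := hy.2
      change p * s + q * t < p * x.1 + q * y.1
      gcongr

end Sections

/-! ### Volumes of caps -/

section Caps

variable {n : ℕ}

lemma volume_real_prod_pi_Icc {x y : ℝ} (hxy : x ≤ y) (c : Fin n → ℝ) {ρ : ℝ} (hρ : 0 ≤ ρ) :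
    volume.real (Ioc x y ×ˢ Set.pi univ fun i => Icc (c i - ρ) (c i + ρ)) =
      (y - x) * (2 * ρ) ^ n := by
  rw [Measure.volume_eq_prod, measureReal_prod_prod, Real.volume_real_Ioc_of_le hxy]
  congr 1
  rw [measureReal_def, volume_pi_pi, ENNReal.toReal_prod]
  simp only [Real.volume_Icc, add_sub_sub_cancel]
  rw [Finset.prod_const, ENNReal.toReal_ofReal (by positivity)]
  simp [two_mul]

variable {K : Set (ℝ × (Fin n → ℝ))}

/-- If `K` lies in a ball and touches it at the level `b`, then the part of `K` above the level
`b - h` has volume `O(h ^ (1 + n / 2))`. -/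
lemma not_linear_le_one_sub_fstCdf (hn : n ≠ 0) (hK : IsCompact K) (hKi : (interior K).Nonempty)
    {a b : ℝ} (hab : Prod.fst '' K = Icc a b) (hlt : a < b) {y : ℝ × (Fin n → ℝ)} {R : ℝ}
    (hR : 0 < R) (hb : b = y.1 + R)
    (hball : ∀ p ∈ K, (p.1 - y.1) ^ 2 + ∑ i, (p.2 i - y.2 i) ^ 2 ≤ R ^ 2) :
    ¬ ∃ c > 0, ∀ s ∈ Ioo a b, c * (b - s) ≤ 1 - fstCdf K s := by
  rintro ⟨c, hc, hcs⟩
  have hV := volume_real_pos hK hKi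
  have hlim : Tendsto (fun h : ℝ => (2 * Real.sqrt (2 * R * h)) ^ n) (𝓝[>] 0) (𝓝 0) := by
    have : Continuous fun h : ℝ => (2 * Real.sqrt (2 * R * h)) ^ n := by fun_prop
    simpa [hn] using (this.tendsto 0).mono_left nhdsWithin_le_nhds
  have h1 := hlim.eventually (gt_mem_nhds (show 0 < c * volume.real K by positivity))
  have h2 : ∀ᶠ h : ℝ in 𝓝[>] 0, h < b - a :=
    nhdsWithin_le_nhds (Iio_mem_nhds (by linarith))
  have h3 : ∀ᶠ h : ℝ in 𝓝[>] 0, h < R := nhdsWithin_le_nhds (Iio_mem_nhds hR)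
  obtain ⟨h, hh1, hh2, hh3, hh0⟩ := (h1.and (h2.and (h3.and self_mem_nhdsWithin))).exists
  have hh0 : 0 < h := hh0
  have hs := hcs (b - h) ⟨by linarith, by linarith⟩
  rw [one_sub_fstCdf hK hV, le_div_iff₀ hV] at hs
  have hρ := Real.sqrt_nonneg (2 * R * h)
  have hρ2 : Real.sqrt (2 * R * h) ^ 2 = 2 * R * h := Real.sq_sqrt (by positivity)
  set ρ := Real.sqrt (2 * R * h)
  have hsub : K ∩ Prod.fst ⁻¹' Ioi (b - h) ⊆
      Ioc (b - h) b ×ˢ Set.pi univ fun i => Icc (y.2 i - ρ) (y.2 i + ρ) := by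
    rintro p ⟨hpK, hp⟩
    have hp : b - h < p.1 := hp
    have hpb : p.1 ∈ Icc a b := by rw [← hab]; exact mem_image_of_mem _ hpK
    refine ⟨⟨hp, hpb.2⟩, fun i _ => ?_⟩
    have h4 := hball p hpK
    have h5 : (p.2 i - y.2 i) ^ 2 ≤ ∑ i, (p.2 i - y.2 i) ^ 2 :=
      Finset.single_le_sum (f := fun i => (p.2 i - y.2 i) ^ 2) (fun i _ => sq_nonneg _)
        (Finset.mem_univ i)
    have h6 : |p.2 i - y.2 i| ≤ ρ := by
      refine abs_le_of_sq_le_sq ?_ hρ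
      nlinarith
    rw [abs_le] at h6
    constructor <;> linarith [h6.1, h6.2]
  have hfin : volume (Ioc (b - h) b ×ˢ Set.pi univ fun i => Icc (y.2 i - ρ) (y.2 i + ρ)) ≠ ⊤ := by
    have hc : IsCompact (Icc (b - h) b ×ˢ Set.pi univ fun i => Icc (y.2 i - ρ) (y.2 i + ρ)) :=
      isCompact_Icc.prod (isCompact_univ_pi fun i => isCompact_Icc)
    exact ne_top_of_le_ne_top hc.measure_lt_top.ne (measure_mono (prod_mono_left Ioc_subset_Icc_self))
  have hvol := measureReal_mono hsub hfin
  rw [volume_real_prod_pi_Icc (by linarith) _ hρ] at hvol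
  have h7 : h * (c * volume.real K) ≤ h * (2 * ρ) ^ n := by
    calc h * (c * volume.real K) = c * (b - (b - h)) * volume.real K := by ring
      _ ≤ (b - (b - h)) * (2 * ρ) ^ n := hs.trans hvol
      _ = _ := by ring
  exact absurd (le_of_mul_le_mul_left h7 hh0) (not_le.2 hh1)

/-- If `K` contains a ball that reaches the maximal level `b`, then the part of `K` above the level
`b - h` has volume at least of the order `h ^ (1 + n / 2)`. -/
lemma not_one_sub_fstCdf_eq_pow (hn : n ≠ 0) (hK : IsCompact K) (hKi : (interior K).Nonempty)
    {b : ℝ} {y : ℝ × (Fin n → ℝ)} {r : ℝ} (hr : 0 < r) (hb : b = y.1 + r)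
    (hball : ∀ p : ℝ × (Fin n → ℝ), (p.1 - y.1) ^ 2 + ∑ i, (p.2 i - y.2 i) ^ 2 < r ^ 2 → p ∈ K) :
    ¬ ∃ k > 0, ∃ m < b, ∀ s ∈ Ioo m b, 1 - fstCdf K s = (k * (b - s)) ^ (n + 1) := by
  rintro ⟨k, hk, m, hm, hks⟩
  have hV := volume_real_pos hK hKi
  have hn0 : (0 : ℝ) < n := by exact_mod_cast Nat.pos_of_ne_zero hn
  set τ := Real.sqrt (r / (4 * n)) with hτ
  have hτ0 : 0 < τ := Real.sqrt_pos.2 (by positivity)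
  have hτ2 : τ ^ 2 = r / (4 * n) := Real.sq_sqrt (by positivity)
  have hlim : Tendsto (fun h : ℝ => 2 * volume.real K * k ^ (n + 1) * (Real.sqrt h) ^ n)
      (𝓝[>] 0) (𝓝 0) := by
    have : Continuous fun h : ℝ => 2 * volume.real K * k ^ (n + 1) * (Real.sqrt h) ^ n := by
      fun_prop
    simpa [hn] using (this.tendsto 0).mono_left nhdsWithin_le_nhds
  have h1 := hlim.eventually (gt_mem_nhds (show 0 < (2 * τ) ^ n by positivity))
  have h2 : ∀ᶠ h : ℝ in 𝓝[>] 0, h < b - m :=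
    nhdsWithin_le_nhds (Iio_mem_nhds (by linarith))
  have h3 : ∀ᶠ h : ℝ in 𝓝[>] 0, h < r := nhdsWithin_le_nhds (Iio_mem_nhds hr)
  obtain ⟨h, hh1, hh2, hh3, hh0⟩ := (h1.and (h2.and (h3.and self_mem_nhdsWithin))).exists
  have hh0 : 0 < h := hh0
  have hs := hks (b - h) ⟨by linarith, by linarith⟩
  rw [one_sub_fstCdf hK hV, div_eq_iff hV.ne'] at hs
  have hq0 : 0 < Real.sqrt h := Real.sqrt_pos.2 hh0
  have hq2 : Real.sqrt h ^ 2 = h := Real.sq_sqrt hh0.le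
  set q := Real.sqrt h
  have hsub : Ioc (b - h) (b - h / 2) ×ˢ
      (Set.pi univ fun i => Icc (y.2 i - τ * q) (y.2 i + τ * q)) ⊆
      K ∩ Prod.fst ⁻¹' Ioi (b - h) := by
    rintro p ⟨hp1, hp2⟩
    refine ⟨hball p ?_, hp1.1⟩
    have h4 : ∀ i ∈ Finset.univ, (p.2 i - y.2 i) ^ 2 ≤ r * h / (4 * n) := by
      intro i _
      have h5 := hp2 i (mem_univ i)
      calc (p.2 i - y.2 i) ^ 2 ≤ (τ * q) ^ 2 := by
            refine sq_le_sq' ?_ ?_ <;> linarith [h5.1, h5.2]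
        _ = r * h / (4 * n) := by rw [mul_pow, hτ2, hq2]; ring
    have h6 := Finset.sum_le_card_nsmul Finset.univ (fun i => (p.2 i - y.2 i) ^ 2) _ h4
    simp only [Finset.card_univ, Fintype.card_fin, nsmul_eq_mul] at h6
    have h7 : (n : ℝ) * (r * h / (4 * n)) = r * h / 4 := by field_simp
    rw [h7] at h6
    have h8 : (p.1 - y.1) ^ 2 ≤ (r - h / 2) ^ 2 := by
      refine sq_le_sq' ?_ ?_ <;> linarith [hp1.1, hp1.2]
    nlinarith
  have hvol := measureReal_mono (μ := volume) hsub
    (ne_top_of_le_ne_top hK.measure_lt_top.ne (measure_mono inter_subset_left))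
  rw [volume_real_prod_pi_Icc (by linarith) _ (by positivity), hs] at hvol
  have h9 : (h / 2 * q ^ n) * (2 * τ) ^ n ≤
      (h / 2 * q ^ n) * (2 * volume.real K * k ^ (n + 1) * q ^ n) := by
    calc (h / 2 * q ^ n) * (2 * τ) ^ n = (b - h / 2 - (b - h)) * (2 * (τ * q)) ^ n := by
          rw [← mul_assoc 2 τ q, mul_pow (2 * τ) q]; ring
      _ ≤ (k * (b - (b - h))) ^ (n + 1) * volume.real K := hvol
      _ = k ^ (n + 1) * (h * h ^ n) * volume.real K := by ring
      _ = _ := by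
        nth_rw 2 [← hq2]
        ring
  exact absurd (le_of_mul_le_mul_left h9 (by positivity)) (not_le.2 hh1)

end Caps

/-! ### The mean length of a projected difference -/

/-- `E|Y₁ - Y₂| = 2 ∫ F (1 - F)` for independent real random variables with distribution
function `F` and values in `[a, b]`. -/
lemma integral_abs_sub_eq_integral_cdf (ν : Measure ℝ) [IsProbabilityMeasure ν] {a b : ℝ}
    (hab : a ≤ b) (hν : ν (Icc a b)ᶜ = 0) :
    ∫ p : ℝ × ℝ, |p.1 - p.2| ∂ν.prod ν =
      ∫ s in a..b, 2 * ν.real (Iic s) * (1 - ν.real (Iic s)) := by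
  have hG : ∀ s, 1 - ν.real (Iic s) = ν.real (Ioi s) := fun s => by
    rw [← probReal_compl_eq_one_sub measurableSet_Iic, compl_Iic]
  have hmono : Monotone fun s => ν.real (Iic s) := fun s t hst =>
    measureReal_mono (Iic_subset_Iic.2 hst)
  have hnn : ∀ s, 0 ≤ 2 * ν.real (Iic s) * (1 - ν.real (Iic s)) := fun s => by
    rw [hG]; positivity
  have hlin : ∫⁻ p : ℝ × ℝ, ENNReal.ofReal |p.1 - p.2| ∂ν.prod ν =
      ∫⁻ s, ENNReal.ofReal (2 * ν.real (Iic s) * (1 - ν.real (Iic s))) := by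
    have hlen : ∀ p : ℝ × ℝ, ENNReal.ofReal |p.1 - p.2| =
        ∫⁻ s, ((Ico p.1 p.2).indicator 1 s + (Ico p.2 p.1).indicator 1 s) := by
      intro p
      rw [lintegral_add_left (measurable_one.indicator measurableSet_Ico),
        lintegral_indicator_one measurableSet_Ico, lintegral_indicator_one measurableSet_Ico,
        Real.volume_Ico, Real.volume_Ico]
      rcases le_total p.1 p.2 with h | h
      · rw [abs_of_nonpos (by linarith), ENNReal.ofReal_of_nonpos (by linarith : p.1 - p.2 ≤ 0)]
        simp
      · rw [abs_of_nonneg (by linarith), ENNReal.ofReal_of_nonpos (by linarith : p.2 - p.1 ≤ 0)]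
        simp
    simp_rw [hlen]
    have hm1 : MeasurableSet {z : (ℝ × ℝ) × ℝ | z.1.1 ≤ z.2 ∧ z.2 < z.1.2} :=
      MeasurableSet.inter (s₁ := {z : (ℝ × ℝ) × ℝ | z.1.1 ≤ z.2}) (s₂ := {z : (ℝ × ℝ) × ℝ | z.2 < z.1.2})
        (measurableSet_le (by fun_prop) (by fun_prop))
        (measurableSet_lt (by fun_prop) (by fun_prop))
    have hm2 : MeasurableSet {z : (ℝ × ℝ) × ℝ | z.1.2 ≤ z.2 ∧ z.2 < z.1.1} :=
      MeasurableSet.inter (s₁ := {z : (ℝ × ℝ) × ℝ | z.1.2 ≤ z.2}) (s₂ := {z : (ℝ × ℝ) × ℝ | z.2 < z.1.1})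
        (measurableSet_le (by fun_prop) (by fun_prop))
        (measurableSet_lt (by fun_prop) (by fun_prop))
    rw [lintegral_lintegral_swap]
    · refine lintegral_congr fun s => ?_
      have e1 : ∀ p : ℝ × ℝ, (Ico p.1 p.2).indicator (1 : ℝ → ENNReal) s =
          (Iic s ×ˢ Ioi s).indicator 1 p := by
        intro p; simp only [indicator, mem_Ico, mem_prod, mem_Iic, mem_Ioi, Pi.one_apply]
      have e2 : ∀ p : ℝ × ℝ, (Ico p.2 p.1).indicator (1 : ℝ → ENNReal) s =
          (Ioi s ×ˢ Iic s).indicator 1 p := by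
        intro p; simp only [indicator, mem_Ico, mem_prod, mem_Iic, mem_Ioi, Pi.one_apply, and_comm]
      simp_rw [e1, e2]
      rw [lintegral_add_left (measurable_one.indicator (measurableSet_Iic.prod measurableSet_Ioi)),
        lintegral_indicator_one (measurableSet_Iic.prod measurableSet_Ioi),
        lintegral_indicator_one (measurableSet_Ioi.prod measurableSet_Iic),
        Measure.prod_prod, Measure.prod_prod, hG, ENNReal.ofReal_mul (by positivity),
        ENNReal.ofReal_mul (by positivity), ofReal_measureReal, ofReal_measureReal]
      simp only [ENNReal.ofReal_ofNat]
      ring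
    · refine Measurable.aemeasurable (Measurable.add ?_ ?_)
      · exact (measurable_one (α := ENNReal)).indicator hm1
      · exact (measurable_one (α := ENNReal)).indicator hm2
  have hmeas : Measurable fun s => 2 * ν.real (Iic s) * (1 - ν.real (Iic s)) := by
    have := hmono.measurable
    fun_prop
  rw [integral_eq_lintegral_of_nonneg_ae (.of_forall fun p => abs_nonneg _)
      (by fun_prop), hlin,
    ← integral_eq_lintegral_of_nonneg_ae (.of_forall hnn) hmeas.aestronglyMeasurable,
    intervalIntegral.integral_of_le hab, ← integral_Icc_eq_integral_Ioc]
  refine (setIntegral_eq_integral_of_forall_compl_eq_zero fun s hs => ?_).symm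
  rcases lt_or_ge s a with h | h
  · have : ν.real (Iic s) = 0 := by
      refine (measureReal_eq_zero_iff).2 (measure_mono_null ?_ hν)
      intro x hx hx'
      exact absurd hx'.1 (not_le.2 (lt_of_le_of_lt hx h))
    simp [this]
  · have : ν.real (Ioi s) = 0 := by
      refine (measureReal_eq_zero_iff).2 (measure_mono_null ?_ hν)
      intro x hx hx'
      exact hs ⟨h, (le_of_lt hx).trans hx'.2⟩
    rw [hG, this, mul_zero]

/-! ### Projections of the uniform distribution -/

section Projections

variable {d n : ℕ}

/-- Orthonormal coordinates whose first coordinate is the component along the unit vector `u`. -/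
lemma exists_coordinates (u : EuclideanSpace ℝ (Fin (n + 1))) (hu : ‖u‖ = 1) :
    ∃ Ψ : EuclideanSpace ℝ (Fin (n + 1)) ≃L[ℝ] ℝ × (Fin n → ℝ), MeasurePreserving Ψ ∧
      (∀ x, (Ψ x).1 = inner ℝ u x) ∧
      ∀ x, ‖x‖ ^ 2 = (Ψ x).1 ^ 2 + ∑ i, (Ψ x).2 i ^ 2 := by
  obtain ⟨L, hL⟩ := exists_isometry_map_eq u (EuclideanSpace.single 0 1) (by simp [hu])
  let Ψ := (L.toContinuousLinearEquiv.trans (EuclideanSpace.equiv (Fin (n + 1)) ℝ)).trans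
    (Fin.consEquivL ℝ (fun _ : Fin (n + 1) => ℝ)).symm
  have h1 : ∀ x, (Ψ x).1 = (L x) 0 := fun x => rfl
  have h2 : ∀ x i, (Ψ x).2 i = (L x) i.succ := fun x i => rfl
  refine ⟨Ψ, ?_, fun x => ?_, fun x => ?_⟩
  · exact (volume_preserving_piFinSuccAbove (fun _ : Fin (n + 1) => ℝ) 0).comp
      ((PiLp.volume_preserving_ofLp (Fin (n + 1))).comp L.measurePreserving)
  · rw [h1, ← L.inner_map_map u x, hL, EuclideanSpace.inner_single_left]
    simp
  · rw [← L.norm_map, EuclideanSpace.real_norm_sq_eq, Fin.sum_univ_succ, h1]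
    simp [h2]

lemma IsConvexBody.volume_real_pos {K : Set (EuclideanSpace ℝ (Fin d))} (hK : IsConvexBody K) :
    0 < volume.real K :=
  MeanDistance.volume_real_pos hK.isCompact hK.nonempty_interior

lemma IsConvexBody.isProbabilityMeasure {K : Set (EuclideanSpace ℝ (Fin d))}
    (hK : IsConvexBody K) : IsProbabilityMeasure (uniformLaw K) :=
  cond_isProbabilityMeasure_of_finite
    (fun h => hK.volume_real_pos.ne' (by rw [measureReal_def, h]; rfl))
    hK.isCompact.measure_lt_top.ne

lemma IsConvexBody.ae_mem {K : Set (EuclideanSpace ℝ (Fin d))} (hK : IsConvexBody K) :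
    ∀ᵐ x ∂uniformLaw K, x ∈ K :=
  ae_cond_mem hK.isCompact.measurableSet

lemma IsConvexBody.nonempty {K : Set (EuclideanSpace ℝ (Fin d))} (hK : IsConvexBody K) :
    K.Nonempty :=
  hK.nonempty_interior.mono interior_subset

lemma IsConvexBody.nonempty_interior_image {K : Set (EuclideanSpace ℝ (Fin d))}
    (hK : IsConvexBody K) {X : Type*} [NormedAddCommGroup X] [NormedSpace ℝ X]
    (Ψ : EuclideanSpace ℝ (Fin d) ≃L[ℝ] X) : (interior (Ψ '' K)).Nonempty := by
  have h : Ψ '' interior K = interior (Ψ '' K) := Ψ.toHomeomorph.image_interior K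
  rw [← h]
  exact hK.nonempty_interior.image _

lemma uniformLaw_real {K : Set (EuclideanSpace ℝ (Fin d))} (hK : IsConvexBody K)
    (A : Set (EuclideanSpace ℝ (Fin d))) :
    (uniformLaw K).real A = volume.real (K ∩ A) / volume.real K := by
  rw [uniformLaw, measureReal_def, cond_apply hK.isCompact.measurableSet, ENNReal.toReal_mul,
    ENNReal.toReal_inv, ← measureReal_def, ← measureReal_def, div_eq_inv_mul]

/-- The mean length `E |⟪u, X₁ - X₂⟫|` of the projection of the segment between two independent
uniform random points of `K`. -/
noncomputable def meanProj (K : Set (EuclideanSpace ℝ (Fin d))) (u : EuclideanSpace ℝ (Fin d)) :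
    ℝ :=
  ∫ p : EuclideanSpace ℝ (Fin d) × EuclideanSpace ℝ (Fin d), |inner ℝ u (p.1 - p.2)|
    ∂((uniformLaw K).prod (uniformLaw K))

/-- The distribution function of `⟪u, X⟫` for a uniform random point `X` of `K`. -/
noncomputable def projCdf (K : Set (EuclideanSpace ℝ (Fin d))) (u : EuclideanSpace ℝ (Fin d))
    (s : ℝ) : ℝ :=
  (uniformLaw K).real {x | inner ℝ u x ≤ s}

lemma exists_image_inner_eq_Icc {K : Set (EuclideanSpace ℝ (Fin d))} (hK : IsConvexBody K)
    (u : EuclideanSpace ℝ (Fin d)) :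
    ∃ a b : ℝ, a ≤ b ∧ (fun x => inner ℝ u x) '' K = Icc a b := by
  have hc : Continuous fun x : EuclideanSpace ℝ (Fin d) => (inner ℝ u x : ℝ) := by fun_prop
  have hconn : IsConnected ((fun x => (inner ℝ u x : ℝ)) '' K) :=
    (hK.convex.isConnected hK.nonempty).image _ hc.continuousOn
  have h := eq_Icc_of_connected_compact hconn (hK.isCompact.image hc)
  refine ⟨_, _, ?_, h⟩
  have := hconn.nonempty
  rw [h] at this
  exact nonempty_Icc.1 this

lemma meanProj_eq_integral {K : Set (EuclideanSpace ℝ (Fin d))} (hK : IsConvexBody K)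
    (u : EuclideanSpace ℝ (Fin d)) {a b : ℝ} (hab : a ≤ b)
    (hI : (fun x => inner ℝ u x) '' K = Icc a b) :
    meanProj K u = ∫ s in a..b, 2 * projCdf K u s * (1 - projCdf K u s) := by
  have := hK.isProbabilityMeasure
  have hm : Measurable fun x : EuclideanSpace ℝ (Fin d) => (inner ℝ u x : ℝ) := by fun_prop
  have := Measure.isProbabilityMeasure_map (μ := uniformLaw K) hm.aemeasurable
  have h := integral_abs_sub_eq_integral_cdf ((uniformLaw K).map fun x => inner ℝ u x) hab (by
    rw [Measure.map_apply hm measurableSet_Icc.compl]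
    refine measure_mono_null ?_ (ae_iff.1 hK.ae_mem)
    intro x hx hxK
    exact hx (by rw [← hI]; exact mem_image_of_mem _ hxK))
  have hF : ∀ s, ((uniformLaw K).map fun x => inner ℝ u x).real (Iic s) = projCdf K u s :=
    fun s => by
      rw [map_measureReal_apply hm measurableSet_Iic]; rfl
  simp_rw [hF] at h
  rw [← h, Measure.map_prod_map _ _ hm hm, integral_map (by fun_prop) (by fun_prop), meanProj]
  simp [inner_sub_right]

lemma projLength_eq {K : Set (EuclideanSpace ℝ (Fin d))} {u : EuclideanSpace ℝ (Fin d)} {a b : ℝ}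
    (hab : a ≤ b) (hI : (fun x => inner ℝ u x) '' K = Icc a b) : projLength K u = b - a := by
  rw [projLength, hI, Real.volume_real_Icc_of_le hab]

/-- The law of `⟪u, X⟫` is that of the first coordinate of a uniform random point in a rotated
copy `Ψ '' K` of the body. -/
lemma projCdf_eq_fstCdf {K : Set (EuclideanSpace ℝ (Fin (n + 1)))} (hK : IsConvexBody K)
    {u : EuclideanSpace ℝ (Fin (n + 1))}
    {Ψ : EuclideanSpace ℝ (Fin (n + 1)) ≃L[ℝ] ℝ × (Fin n → ℝ)} (hΨ : MeasurePreserving Ψ)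
    (hΨu : ∀ x, (Ψ x).1 = inner ℝ u x) : projCdf K u = fstCdf (Ψ '' K) := by
  have hemb : MeasurableEmbedding Ψ := Ψ.toHomeomorph.measurableEmbedding
  have hvol : ∀ A, volume.real (Ψ '' A) = volume.real A := fun A => by
    rw [measureReal_def, measureReal_def, ← hΨ.measure_preimage_emb hemb (Ψ '' A),
      preimage_image_eq _ Ψ.injective]
  ext s
  rw [projCdf, uniformLaw_real hK, fstCdf, hvol, ← hvol (K ∩ _), image_inter Ψ.injective]
  congr 3
  ext p
  obtain ⟨x, rfl⟩ := Ψ.surjective p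
  simp [hΨu]

lemma exists_isProjectionLaw {K : Set (EuclideanSpace ℝ (Fin (n + 1)))} (hK : IsConvexBody K)
    {u : EuclideanSpace ℝ (Fin (n + 1))}
    {Ψ : EuclideanSpace ℝ (Fin (n + 1)) ≃L[ℝ] ℝ × (Fin n → ℝ)} (hΨ : MeasurePreserving Ψ)
    (hΨu : ∀ x, (Ψ x).1 = inner ℝ u x) :
    ∃ a b f, (fun x => inner ℝ u x) '' K = Icc a b ∧ Prod.fst '' (Ψ '' K) = Icc a b ∧
      IsProjectionLaw (n + 1) a b (projCdf K u) f := by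
  obtain ⟨a, b, hab, hI⟩ := exists_image_inner_eq_Icc hK u
  have hI' : Prod.fst '' (Ψ '' K) = Icc a b := by rw [← hI, image_image]; simp [hΨu]
  have hΨi := hK.nonempty_interior_image Ψ
  have hlt : a < b := by
    obtain ⟨p, hp⟩ := hΨi
    have hopen : IsOpen (Prod.fst '' interior (Ψ '' K)) := isOpenMap_fst _ isOpen_interior
    have hsub : Prod.fst '' interior (Ψ '' K) ⊆ Icc a b := by
      rw [← hI']; exact image_mono interior_subset
    refine lt_of_le_of_ne hab ?_
    rintro rfl
    rw [Icc_self] at hsub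
    have hpos := hopen.measure_pos volume ⟨_, mem_image_of_mem _ hp⟩
    exact hpos.ne' (measure_mono_null hsub (by simp))
  rw [projCdf_eq_fstCdf hK hΨ hΨu]
  exact ⟨a, b, _, hI, hI', isProjectionLaw_fstCdf (hK.isCompact.image Ψ.continuous)
    (hK.convex.linear_image Ψ.toLinearEquiv.toLinearMap) hΨi hI' hlt⟩

lemma projection_bounds {K : Set (EuclideanSpace ℝ (Fin (n + 1)))} (hK : IsConvexBody K)
    {u : EuclideanSpace ℝ (Fin (n + 1))} (hu : ‖u‖ = 1) :
    0 < projLength K u ∧ lowerConst (n + 1) * projLength K u ≤ meanProj K u ∧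
      meanProj K u ≤ projLength K u / 3 := by
  obtain ⟨Ψ, hΨ, hΨu, -⟩ := exists_coordinates u hu
  obtain ⟨a, b, f, hI, -, hF⟩ := exists_isProjectionLaw hK hΨ hΨu
  rw [projLength_eq hF.lt.le hI, meanProj_eq_integral hK u hF.lt.le hI]
  exact ⟨sub_pos.2 hF.lt, (lowerConst_mul_le_integral n.succ_pos hF.lt hF.continuousOn hF.left
    hF.right hF.hasDerivAt hF.pos hF.concaveOn_rpow hF.concaveOn_one_sub_rpow).1,
    (integral_le_of_logConcave hF.lt hF.continuousOn hF.left hF.right hF.hasDerivAt hF.pos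
      hF.concaveOn_log).1⟩

/-- The upper bound is strict in the direction of a diameter of `K`. -/
lemma exists_meanProj_lt (hn : n ≠ 0) {K : Set (EuclideanSpace ℝ (Fin (n + 1)))}
    (hK : IsConvexBody K) :
    ∃ u : EuclideanSpace ℝ (Fin (n + 1)), ‖u‖ = 1 ∧ meanProj K u < projLength K u / 3 := by
  obtain ⟨⟨x, y⟩, ⟨hx, hy⟩, hmax⟩ := (hK.isCompact.prod hK.isCompact).exists_isMaxOn
    (hK.nonempty.prod hK.nonempty) (f := fun p => ‖p.1 - p.2‖) (by fun_prop)
  have hmax' : ∀ z ∈ K, ‖z - y‖ ≤ ‖x - y‖ := fun z hz =>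
    isMaxOn_iff.1 hmax (z, y) ⟨hz, hy⟩
  set R := ‖x - y‖ with hR
  have hR0 : 0 < R := by
    refine (norm_nonneg _).lt_of_ne' fun h0 => ?_
    have hK1 : K ⊆ {y} := fun z hz => by
      have := hmax' z hz
      rw [hR, h0] at this
      exact sub_eq_zero.1 (norm_le_zero_iff.1 this)
    have := hK.nonempty_interior.mono (interior_mono hK1)
    simp at this
  set u := R⁻¹ • (x - y) with hu
  have hu1 : ‖u‖ = 1 := by
    rw [hu, norm_smul, ← hR, norm_inv, Real.norm_of_nonneg hR0.le, inv_mul_cancel₀ hR0.ne']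
  have hux : (inner ℝ u (x - y) : ℝ) = R := by
    rw [hu, inner_smul_left, real_inner_self_eq_norm_sq, ← hR]
    simp only [conj_trivial]
    field_simp
  obtain ⟨Ψ, hΨ, hΨu, hΨn⟩ := exists_coordinates u hu1
  obtain ⟨a, b, f, hI, hI', hF⟩ := exists_isProjectionLaw hK hΨ hΨu
  refine ⟨u, hu1, lt_of_le_of_ne (projection_bounds hK hu1).2.2 fun heq => ?_⟩
  rw [projLength_eq hF.lt.le hI, meanProj_eq_integral hK u hF.lt.le hI] at heq
  have h := (integral_le_of_logConcave hF.lt hF.continuousOn hF.left hF.right hF.hasDerivAt hF.pos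
      hF.concaveOn_log).2 heq
  rw [projCdf_eq_fstCdf hK hΨ hΨu] at h
  have hb : b = (Ψ y).1 + R := by
    rw [hΨu]
    rw [inner_sub_right] at hux
    have hbx : inner ℝ u x ∈ Icc a b := by rw [← hI]; exact mem_image_of_mem _ hx
    obtain ⟨z, hz, hzb⟩ : b ∈ (fun x => inner ℝ u x) '' K := by
      rw [hI]; exact right_mem_Icc.2 hF.lt.le
    have h1 : (inner ℝ u (z - y) : ℝ) ≤ R := by
      refine (real_inner_le_norm _ _).trans ?_
      rw [hu1, one_mul]; exact hmax' z hz
    rw [inner_sub_right] at h1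
    simp only at hzb
    linarith [hbx.2]
  refine not_linear_le_one_sub_fstCdf hn (hK.isCompact.image Ψ.continuous) ?_ hI' hF.lt hR0 hb ?_ h
  · exact hK.nonempty_interior_image Ψ
  · rintro _ ⟨z, hz, rfl⟩
    have h1 := hΨn (z - y)
    rw [map_sub] at h1
    simp only [Prod.fst_sub, Prod.snd_sub, Pi.sub_apply] at h1
    rw [← h1]
    exact pow_le_pow_left₀ (norm_nonneg _) (hmax' z hz) 2

/-- There is a ball inside `K` that touches a supporting hyperplane of `K`. -/
lemma exists_ball_subset_touching {K : Set (EuclideanSpace ℝ (Fin d))} (hK : IsConvexBody K)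
    (hd : d ≠ 0) :
    ∃ (u z : EuclideanSpace ℝ (Fin d)) (r : ℝ), ‖u‖ = 1 ∧ 0 < r ∧ Metric.ball z r ⊆ K ∧
      IsGreatest ((fun x => inner ℝ u x) '' K) (inner ℝ u z + r) := by
  obtain ⟨z, hz⟩ := hK.nonempty_interior
  have hne : (Kᶜ : Set (EuclideanSpace ℝ (Fin d))).Nonempty := by
    rw [nonempty_compl]
    rintro rfl
    have : Nonempty (Fin d) := ⟨⟨0, Nat.pos_of_ne_zero hd⟩⟩
    exact noncompact_univ _ hK.isCompact
  -- The ball around an interior point `z` with radius the distance of `z` to the complement.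
  set r := Metric.infDist z Kᶜ with hr
  have hr0 : 0 < r := by
    rw [hr, ← Metric.infDist_closure]
    refine (isClosed_closure.notMem_iff_infDist_pos hne.closure).1 ?_
    rwa [closure_compl, notMem_compl_iff]
  have hball : Metric.ball z r ⊆ K := by
    have := Metric.ball_infDist_compl_subset (s := K) (x := z)
    exact this
  obtain ⟨w, hw, hwr⟩ : ∃ w ∈ closure Kᶜ, Metric.infDist z (closure Kᶜ) = dist z w :=
    isClosed_closure.exists_infDist_eq_dist hne.closure z
  rw [Metric.infDist_closure, ← hr] at hwr
  rw [closure_compl] at hw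
  obtain ⟨ℓ, hℓ⟩ := geometric_hahn_banach_open_point hK.convex.interior isOpen_interior hw
  set v := (InnerProductSpace.toDual ℝ _).symm ℓ with hv
  have hℓv : ∀ x, ℓ x = inner ℝ v x := fun x => by
    rw [hv, InnerProductSpace.toDual_symm_apply]
  have hv0 : 0 < ‖v‖ := by
    refine norm_pos_iff.2 fun h0 => ?_
    have := hℓ z hz
    simp [hℓv, h0] at this
  have hle : ∀ x ∈ K, ℓ x ≤ ℓ w := by
    have hcl : K ⊆ closure (interior K) := by
      rw [hK.convex.closure_interior_eq_closure_of_nonempty_interior hK.nonempty_interior]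
      exact subset_closure
    intro x hx
    exact closure_minimal (t := {x | ℓ x ≤ ℓ w}) (fun y hy => (hℓ y hy).le)
      (isClosed_le ℓ.continuous continuous_const) (hcl hx)
  set u := ‖v‖⁻¹ • v with hu
  have hu1 : ‖u‖ = 1 := by
    rw [hu, norm_smul, norm_inv, norm_norm, inv_mul_cancel₀ hv0.ne']
  have huℓ : ∀ x, inner ℝ u x = ‖v‖⁻¹ * ℓ x := fun x => by
    rw [hu, inner_smul_left, hℓv]; simp
  have hule : ∀ x ∈ K, (inner ℝ u x : ℝ) ≤ inner ℝ u w := fun x hx => by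
    rw [huℓ, huℓ]; exact mul_le_mul_of_nonneg_left (hle x hx) (by positivity)
  have hcball : Metric.closedBall z r ⊆ K := by
    rw [← closure_ball z hr0.ne']
    exact closure_minimal hball hK.isCompact.isClosed
  have htop : z + r • u ∈ K := hcball (by
    rw [mem_closedBall_iff_norm, add_sub_cancel_left, norm_smul, hu1, mul_one,
      Real.norm_of_nonneg hr0.le])
  have hinner : (inner ℝ u (z + r • u) : ℝ) = inner ℝ u z + r := by
    rw [inner_add_right, inner_smul_right, real_inner_self_eq_norm_sq, hu1]; ring
  refine ⟨u, z, r, hu1, hr0, hball, ⟨_, htop, hinner⟩, ?_⟩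
  rintro _ ⟨x, hx, rfl⟩
  refine (hule x hx).trans ?_
  have h1 : (inner ℝ u (w - z) : ℝ) ≤ r := by
    refine (real_inner_le_norm _ _).trans ?_
    rw [hu1, one_mul, hwr, dist_comm, dist_eq_norm]
  rw [inner_sub_right] at h1
  linarith

/-- The lower bound is strict in a direction in which a ball inside `K` touches the boundary. -/
lemma exists_lt_meanProj (hn : n ≠ 0) {K : Set (EuclideanSpace ℝ (Fin (n + 1)))}
    (hK : IsConvexBody K) :
    ∃ u : EuclideanSpace ℝ (Fin (n + 1)), ‖u‖ = 1 ∧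
      lowerConst (n + 1) * projLength K u < meanProj K u := by
  obtain ⟨u, z, r, hu1, hr0, hball, hgr⟩ := exists_ball_subset_touching hK n.succ_ne_zero
  obtain ⟨Ψ, hΨ, hΨu, hΨn⟩ := exists_coordinates u hu1
  obtain ⟨a, b, f, hI, hI', hF⟩ := exists_isProjectionLaw hK hΨ hΨu
  refine ⟨u, hu1, lt_of_le_of_ne (projection_bounds hK hu1).2.1 fun heq => ?_⟩
  rw [projLength_eq hF.lt.le hI, meanProj_eq_integral hK u hF.lt.le hI] at heq
  have h := (lowerConst_mul_le_integral n.succ_pos hF.lt hF.continuousOn hF.left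
    hF.right hF.hasDerivAt hF.pos hF.concaveOn_rpow hF.concaveOn_one_sub_rpow).2 heq
  rw [projCdf_eq_fstCdf hK hΨ hΨu] at h
  have hb : b = (Ψ z).1 + r := by
    rw [hΨu]
    rw [hI] at hgr
    exact (isGreatest_Icc hF.lt.le).unique hgr
  refine not_one_sub_fstCdf_eq_pow hn (hK.isCompact.image Ψ.continuous) ?_ hr0 hb ?_ h
  · exact hK.nonempty_interior_image Ψ
  · intro p hp
    obtain ⟨x, rfl⟩ := Ψ.surjective p
    refine mem_image_of_mem _ (hball ?_)
    have h1 := hΨn (x - z)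
    rw [map_sub] at h1
    simp only [Prod.fst_sub, Prod.snd_sub, Pi.sub_apply] at h1
    rw [← h1] at hp
    rw [mem_ball_iff_norm]
    exact lt_of_pow_lt_pow_left₀ 2 hr0.le hp

end Projections

/-! ### The two-sided inequality -/

section Inequality

variable {d n : ℕ}

lemma IsConvexBody.exists_norm_sub_le {K : Set (EuclideanSpace ℝ (Fin d))} (hK : IsConvexBody K) :
    ∃ M : ℝ, 0 ≤ M ∧ ∀ᵐ p ∂((uniformLaw K).prod (uniformLaw K)), ‖p.1 - p.2‖ ≤ M := by
  have := hK.isProbabilityMeasure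
  refine ⟨Metric.diam K, Metric.diam_nonneg, ?_⟩
  have h1 := Measure.quasiMeasurePreserving_fst (μ := uniformLaw K) (ν := uniformLaw K) |>.ae hK.ae_mem
  have h2 := Measure.quasiMeasurePreserving_snd (μ := uniformLaw K) (ν := uniformLaw K) |>.ae hK.ae_mem
  filter_upwards [h1, h2] with p hp1 hp2
  rw [← dist_eq_norm]
  exact Metric.dist_le_diam_of_mem hK.isCompact.isBounded hp1 hp2

lemma continuous_meanProj {K : Set (EuclideanSpace ℝ (Fin d))} (hK : IsConvexBody K) :
    Continuous fun u : Metric.sphere (0 : EuclideanSpace ℝ (Fin d)) 1 => meanProj K u := by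
  have := hK.isProbabilityMeasure
  obtain ⟨M, -, hM⟩ := hK.exists_norm_sub_le
  refine continuous_of_dominated (bound := fun _ => M)
    (fun u => (by fun_prop : Continuous _).aestronglyMeasurable) (fun u => ?_)
    (integrable_const M) (.of_forall fun p => by fun_prop)
  filter_upwards [hM] with p hp
  rw [Real.norm_eq_abs, abs_abs]
  refine (abs_real_inner_le_norm _ _).trans ?_
  rw [norm_eq_of_mem_sphere, one_mul]
  exact hp

/-- The length of the projection is the difference of two support functions. -/
lemma continuous_projLength {K : Set (EuclideanSpace ℝ (Fin d))} (hK : IsConvexBody K) :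
    Continuous (projLength K) := by
  have h1 : Continuous fun u : EuclideanSpace ℝ (Fin d) => sSup ((fun x => (inner ℝ u x : ℝ)) '' K) :=
    hK.isCompact.continuous_sSup
      (f := fun (u : EuclideanSpace ℝ (Fin d)) x => (inner ℝ u x : ℝ)) (by fun_prop)
  have h2 : Continuous fun u : EuclideanSpace ℝ (Fin d) => sInf ((fun x => (inner ℝ u x : ℝ)) '' K) :=
    hK.isCompact.continuous_sInf
      (f := fun (u : EuclideanSpace ℝ (Fin d)) x => (inner ℝ u x : ℝ)) (by fun_prop)
  refine (h1.sub h2).congr fun u => ?_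
  obtain ⟨a, b, hab, hI⟩ := exists_image_inner_eq_Icc hK u
  rw [projLength_eq hab hI, Pi.sub_apply]
  simp only [hI, csSup_Icc hab, csInf_Icc hab]

/-- The mean distance is the spherical average of the mean projected distances. -/
lemma meanDistance_eq {K : Set (EuclideanSpace ℝ (Fin (n + 1)))} (hK : IsConvexBody K) :
    meanDistance K = widthConst (n + 1) * ⨍ u, meanProj K u ∂sphereMeasure (n + 1) := by
  have := hK.isProbabilityMeasure
  obtain ⟨M, hM0, hM⟩ := hK.exists_norm_sub_le
  have hint : Integrable (Function.uncurry fun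
      (u : Metric.sphere (0 : EuclideanSpace ℝ (Fin (n + 1))) 1)
      (p : EuclideanSpace ℝ (Fin (n + 1)) × EuclideanSpace ℝ (Fin (n + 1))) =>
      |(inner ℝ (u : EuclideanSpace ℝ (Fin (n + 1))) (p.1 - p.2) : ℝ)|)
      ((sphereMeasure (n + 1)).prod ((uniformLaw K).prod (uniformLaw K))) := by
    refine Integrable.of_bound
      (by unfold Function.uncurry; exact (by fun_prop : Continuous _).aestronglyMeasurable) M ?_
    have h2 := Measure.quasiMeasurePreserving_snd (μ := sphereMeasure (n + 1))
      (ν := (uniformLaw K).prod (uniformLaw K)) |>.ae hM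
    filter_upwards [h2] with z hz
    simp only [Function.uncurry]
    rw [Real.norm_eq_abs, abs_abs]
    refine (abs_real_inner_le_norm _ _).trans ?_
    rw [norm_eq_of_mem_sphere, one_mul]
    exact hz
  have hswap := integral_integral_swap hint
  simp only [average_eq, smul_eq_mul, meanProj]
  rw [hswap, ← mul_assoc, ← integral_const_mul, meanDistance]
  refine integral_congr_ae (.of_forall fun p => ?_)
  have h := widthConst_mul_average_abs_inner n (p.1 - p.2)
  simp only [average_eq, smul_eq_mul, ← mul_assoc] at h
  simp only [real_inner_comm (p.1 - p.2)]
  rw [h]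

lemma firstIntrinsicVolume_eq (K : Set (EuclideanSpace ℝ (Fin d))) :
    firstIntrinsicVolume K = widthConst d * ⨍ u, projLength K u ∂sphereMeasure d := rfl

lemma integral_sphere_pos {g : Metric.sphere (0 : EuclideanSpace ℝ (Fin d)) 1 → ℝ}
    (hg : Continuous g) (h0 : ∀ u, 0 ≤ g u) {u : Metric.sphere (0 : EuclideanSpace ℝ (Fin d)) 1}
    (hu : 0 < g u) : 0 < ∫ u, g u ∂sphereMeasure d :=
  hg.integral_pos_of_hasCompactSupport_nonneg_nonzero (.of_compactSpace g) h0 hu.ne'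

lemma integrable_sphere {g : Metric.sphere (0 : EuclideanSpace ℝ (Fin d)) 1 → ℝ}
    (hg : Continuous g) : Integrable g (sphereMeasure d) :=
  hg.integrable_of_hasCompactSupport (.of_compactSpace g)

lemma sphereMeasure_real_univ_pos (n : ℕ) : 0 < (sphereMeasure (n + 1)).real univ := by
  have h := sphereMeasure_real_univ n
  refine measureReal_nonneg.lt_of_ne' fun h0 => ?_
  rw [h0, zero_mul] at h
  exact (pow_pos (Real.sqrt_pos.2 Real.pi_pos) _).ne h

theorem ratio_bounds (hn : n ≠ 0) {K : Set (EuclideanSpace ℝ (Fin (n + 1)))}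
    (hK : IsConvexBody K) :
    lowerConst (n + 1) < meanDistance K / firstIntrinsicVolume K ∧
      meanDistance K / firstIntrinsicVolume K < 1 / 3 := by
  have hP : Continuous fun u : Metric.sphere (0 : EuclideanSpace ℝ (Fin (n + 1))) 1 =>
      projLength K u := (continuous_projLength hK).comp continuous_subtype_val
  have hM := continuous_meanProj hK
  have hb := fun u : Metric.sphere (0 : EuclideanSpace ℝ (Fin (n + 1))) 1 =>
    projection_bounds hK (norm_eq_of_mem_sphere u)
  have hc := widthConst_pos n
  have hσ := sphereMeasure_real_univ_pos n
  obtain ⟨u, hul⟩ : ∃ u : Metric.sphere (0 : EuclideanSpace ℝ (Fin (n + 1))) 1,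
      0 < projLength K u / 3 - meanProj K u := by
    obtain ⟨u, hu, hul⟩ := exists_meanProj_lt hn hK
    exact ⟨⟨u, mem_sphere_zero_iff_norm.2 hu⟩, sub_pos.2 hul⟩
  obtain ⟨v, hvl⟩ : ∃ v : Metric.sphere (0 : EuclideanSpace ℝ (Fin (n + 1))) 1,
      0 < meanProj K v - lowerConst (n + 1) * projLength K v := by
    obtain ⟨v, hv, hvl⟩ := exists_lt_meanProj hn hK
    exact ⟨⟨v, mem_sphere_zero_iff_norm.2 hv⟩, sub_pos.2 hvl⟩
  have hPpos := integral_sphere_pos hP (fun u => (hb u).1.le) (hb u).1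
  have hP3 : Continuous fun u : Metric.sphere (0 : EuclideanSpace ℝ (Fin (n + 1))) 1 =>
      projLength K u / 3 := hP.div_const 3
  have hPl : Continuous fun u : Metric.sphere (0 : EuclideanSpace ℝ (Fin (n + 1))) 1 =>
      lowerConst (n + 1) * projLength K u := hP.const_mul _
  have hup : 0 < ∫ u, (projLength K u / 3 - meanProj K u) ∂sphereMeasure (n + 1) :=
    integral_sphere_pos (hP3.sub hM) (fun u => sub_nonneg.2 (hb u).2.2) hul
  have hlow : 0 < ∫ u, (meanProj K u - lowerConst (n + 1) * projLength K u)
      ∂sphereMeasure (n + 1) :=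
    integral_sphere_pos (hM.sub hPl) (fun u => sub_nonneg.2 (hb u).2.1) hvl
  rw [integral_sub (integrable_sphere hP3) (integrable_sphere hM), integral_div] at hup
  rw [integral_sub (integrable_sphere hM) (integrable_sphere hPl), integral_const_mul] at hlow
  have hratio : meanDistance K / firstIntrinsicVolume K =
      (∫ u, meanProj K u ∂sphereMeasure (n + 1)) / ∫ u, projLength K u ∂sphereMeasure (n + 1) := by
    rw [meanDistance_eq hK, firstIntrinsicVolume_eq, average_eq, average_eq, smul_eq_mul,
      smul_eq_mul, mul_div_mul_left _ _ hc.ne', mul_div_mul_left _ _ (inv_pos.2 hσ).ne']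
  rw [hratio]
  constructor
  · rw [lt_div_iff₀ hPpos]; linarith
  · rw [div_lt_iff₀ hPpos]; linarith

end Inequality

/-! ### Bodies that degenerate to a segment -/

section Thin

variable {n : ℕ}

lemma norm_le_abs_zero_add {x : EuclideanSpace ℝ (Fin (n + 1))} {η : ℝ} (hη : 0 ≤ η)
    (hx : ∀ i, i ≠ 0 → |x i| ≤ η) : ‖x‖ ≤ |x 0| + (n + 1) * η := by
  refine abs_le_of_sq_le_sq' ?_ (by positivity) |>.2
  rw [EuclideanSpace.real_norm_sq_eq, Fin.sum_univ_succ]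
  have h1 : ∑ i : Fin n, x i.succ ^ 2 ≤ n * η ^ 2 := by
    have := Finset.sum_le_card_nsmul Finset.univ (fun i : Fin n => x i.succ ^ 2) (η ^ 2)
      fun i _ => sq_le_sq.2 (by rw [abs_of_nonneg hη]; exact hx i.succ (Fin.succ_ne_zero i))
    simpa using this
  have h2 : (0 : ℝ) ≤ n := n.cast_nonneg
  nlinarith [sq_abs (x 0), abs_nonneg (x 0), mul_nonneg h2 (sq_nonneg η), sq_nonneg η,
    mul_nonneg (abs_nonneg (x 0)) hη, mul_nonneg (mul_nonneg h2 h2) (sq_nonneg η),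
    mul_nonneg (mul_nonneg h2 (abs_nonneg (x 0))) hη]

/-- Convex bodies that lie in the `δ`-tube around the segment `[-e₁, e₁]` and contain it. -/
structure IsThin (K : Set (EuclideanSpace ℝ (Fin (n + 1)))) (δ : ℝ) : Prop where
  isConvexBody : IsConvexBody K
  single_mem : EuclideanSpace.single 0 1 ∈ K
  neg_single_mem : -EuclideanSpace.single 0 1 ∈ K
  abs_zero_le : ∀ x ∈ K, |x 0| ≤ 1
  abs_apply_le : ∀ x ∈ K, ∀ i, i ≠ 0 → |x i| ≤ δ

variable {K : Set (EuclideanSpace ℝ (Fin (n + 1)))} {δ : ℝ}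

lemma IsThin.projLength_bounds (hK : IsThin K δ) (hδ : 0 ≤ δ)
    {u : EuclideanSpace ℝ (Fin (n + 1))} (hu : ‖u‖ = 1) :
    2 * |u 0| ≤ projLength K u ∧ projLength K u ≤ 2 * |u 0| + 2 * ((n + 1) * δ) := by
  obtain ⟨a, b, hab, hI⟩ := exists_image_inner_eq_Icc hK.isConvexBody u
  rw [projLength_eq hab hI]
  have h1 : inner ℝ u (EuclideanSpace.single 0 1) ∈ Icc a b := by
    rw [← hI]; exact mem_image_of_mem _ hK.single_mem
  have h2 : inner ℝ u (-EuclideanSpace.single 0 1) ∈ Icc a b := by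
    rw [← hI]; exact mem_image_of_mem _ hK.neg_single_mem
  rw [inner_neg_right] at h2
  simp only [EuclideanSpace.inner_single_right, one_mul, conj_trivial] at h1 h2
  have hle : ∀ x ∈ K, |(inner ℝ u x : ℝ)| ≤ |u 0| + (n + 1) * δ := by
    intro x hx
    have e : x = x 0 • EuclideanSpace.single 0 1 + (x - x 0 • EuclideanSpace.single 0 1) := by
      abel
    have h3 : ‖x - x 0 • EuclideanSpace.single 0 (1 : ℝ)‖ ≤ (n + 1) * δ := by
      refine (norm_le_abs_zero_add hδ fun i hi => ?_).trans_eq ?_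
      · simpa [hi] using hK.abs_apply_le x hx i hi
      · simp
    rw [e, inner_add_right, inner_smul_right]
    refine (abs_add_le _ _).trans (add_le_add ?_ ?_)
    · rw [abs_mul]
      simp only [EuclideanSpace.inner_single_right, one_mul, conj_trivial]
      exact mul_le_of_le_one_left (abs_nonneg _) (hK.abs_zero_le x hx)
    · refine (abs_real_inner_le_norm _ _).trans ?_
      rw [hu, one_mul]; exact h3
  obtain ⟨x, hx, hxa⟩ : a ∈ (fun x => inner ℝ u x) '' K := by rw [hI]; exact left_mem_Icc.2 hab
  obtain ⟨y, hy, hyb⟩ : b ∈ (fun x => inner ℝ u x) '' K := by rw [hI]; exact right_mem_Icc.2 hab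
  have h3 := abs_le.1 (hle x hx)
  have h4 := abs_le.1 (hle y hy)
  simp only at hxa hyb
  rw [hxa] at h3
  rw [hyb] at h4
  constructor
  · rcases abs_cases (u 0) with h | h <;> linarith [h1.1, h1.2, h2.1, h2.2]
  · linarith [h3.1, h4.2]

lemma IsThin.firstIntrinsicVolume_bounds (hK : IsThin K δ) (hδ : 0 ≤ δ) :
    2 ≤ firstIntrinsicVolume K ∧
      firstIntrinsicVolume K ≤ 2 + widthConst (n + 1) * (2 * ((n + 1) * δ)) := by
  have hP : Continuous fun u : Metric.sphere (0 : EuclideanSpace ℝ (Fin (n + 1))) 1 =>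
      projLength K u := (continuous_projLength hK.isConvexBody).comp continuous_subtype_val
  have hc := widthConst_pos n
  have hσ := sphereMeasure_real_univ_pos n
  have hA : Continuous fun u : Metric.sphere (0 : EuclideanSpace ℝ (Fin (n + 1))) 1 =>
      2 * |(u : EuclideanSpace ℝ (Fin (n + 1))) 0| := by fun_prop
  have h2 : widthConst (n + 1) *
      ⨍ u, 2 * |(u : EuclideanSpace ℝ (Fin (n + 1))) 0| ∂sphereMeasure (n + 1) = 2 := by
    have h := widthConst_mul_average_abs_inner n (EuclideanSpace.single 0 1)
    simp only [EuclideanSpace.inner_single_left, map_one, one_mul, PiLp.norm_single, norm_one] at h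
    rw [average_eq, integral_const_mul, smul_eq_mul]
    rw [average_eq, smul_eq_mul] at h
    linear_combination 2 * h
  have hb := fun u : Metric.sphere (0 : EuclideanSpace ℝ (Fin (n + 1))) 1 =>
    hK.projLength_bounds hδ (norm_eq_of_mem_sphere u)
  have hlow := integral_mono (integrable_sphere hA) (integrable_sphere hP) fun u => (hb u).1
  have hup := integral_mono (integrable_sphere hP)
    (integrable_sphere (hA.add continuous_const)) fun u => (hb u).2
  simp only [Pi.add_apply] at hup
  rw [integral_add (integrable_sphere hA) (integrable_const _), integral_const, smul_eq_mul] at hup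
  rw [average_eq, smul_eq_mul] at h2
  rw [firstIntrinsicVolume_eq, average_eq, smul_eq_mul]
  constructor
  · refine h2.symm.le.trans ?_
    gcongr
  · calc _ ≤ widthConst (n + 1) * (((sphereMeasure (n + 1)).real univ)⁻¹ *
          ((∫ u, 2 * |(u : EuclideanSpace ℝ (Fin (n + 1))) 0| ∂sphereMeasure (n + 1)) +
            (sphereMeasure (n + 1)).real univ * (2 * ((n + 1) * δ)))) := by gcongr
      _ = _ := by
        rw [mul_add, mul_add, h2, inv_mul_cancel_left₀ hσ.ne']

lemma IsThin.meanDistance_bounds (hK : IsThin K δ) (hδ : 0 ≤ δ) :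
    meanProj K (EuclideanSpace.single 0 1) ≤ meanDistance K ∧
      meanDistance K ≤ meanProj K (EuclideanSpace.single 0 1) + (n + 1) * (2 * δ) := by
  have := hK.isConvexBody.isProbabilityMeasure
  obtain ⟨M, -, hM⟩ := hK.isConvexBody.exists_norm_sub_le
  have hle : ∀ x : EuclideanSpace ℝ (Fin (n + 1)),
      |(inner ℝ (EuclideanSpace.single 0 1) x : ℝ)| ≤ ‖x‖ := fun x => by
    simpa using abs_real_inner_le_norm (EuclideanSpace.single 0 1) x
  have hint1 : Integrable (fun p : EuclideanSpace ℝ (Fin (n + 1)) × EuclideanSpace ℝ (Fin (n + 1)) =>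
      ‖p.1 - p.2‖) ((uniformLaw K).prod (uniformLaw K)) := by
    refine Integrable.of_bound (by fun_prop : Continuous _).aestronglyMeasurable M ?_
    filter_upwards [hM] with p hp
    rwa [norm_norm]
  have hint2 : Integrable (fun p : EuclideanSpace ℝ (Fin (n + 1)) × EuclideanSpace ℝ (Fin (n + 1)) =>
      |(inner ℝ (EuclideanSpace.single 0 1) (p.1 - p.2) : ℝ)|)
      ((uniformLaw K).prod (uniformLaw K)) := by
    refine Integrable.of_bound (by fun_prop : Continuous _).aestronglyMeasurable M ?_
    filter_upwards [hM] with p hp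
    rw [Real.norm_eq_abs, abs_abs]
    exact (hle _).trans hp
  refine ⟨integral_mono hint2 hint1 fun p => hle _, ?_⟩
  have hconst : (n + 1) * (2 * δ) = ∫ p : EuclideanSpace ℝ (Fin (n + 1)) ×
      EuclideanSpace ℝ (Fin (n + 1)), (n + 1) * (2 * δ) ∂(uniformLaw K).prod (uniformLaw K) := by
    simp
  rw [hconst, meanProj, ← integral_add hint2 (integrable_const _)]
  refine integral_mono_ae hint1 (hint2.add (integrable_const _)) ?_
  have h1 := Measure.quasiMeasurePreserving_fst (μ := uniformLaw K) (ν := uniformLaw K) |>.ae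
    hK.isConvexBody.ae_mem
  have h2 := Measure.quasiMeasurePreserving_snd (μ := uniformLaw K) (ν := uniformLaw K) |>.ae
    hK.isConvexBody.ae_mem
  filter_upwards [h1, h2] with p hp1 hp2
  have := norm_le_abs_zero_add (x := p.1 - p.2) (η := 2 * δ) (by positivity) fun i hi => by
    have h3 := abs_le.1 (hK.abs_apply_le _ hp1 i hi)
    have h4 := abs_le.1 (hK.abs_apply_le _ hp2 i hi)
    simp only [PiLp.sub_apply]
    rw [abs_le]
    constructor <;> linarith [h3.1, h3.2, h4.1, h4.2]
  simpa [EuclideanSpace.inner_single_left] using this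

/-- For thin bodies the ratio of mean distance and first intrinsic volume tends to the mean
distance of the projections to the first axis, divided by the length of `[-1, 1]`. -/
lemma tendsto_ratio_of_isThin {K : ℝ → Set (EuclideanSpace ℝ (Fin (n + 1)))} {m : ℝ}
    (hK : ∀ δ > 0, IsThin (K δ) δ)
    (hmean : ∀ δ > 0, meanProj (K δ) (EuclideanSpace.single 0 1) = m) :
    Tendsto (fun δ => meanDistance (K δ) / firstIntrinsicVolume (K δ)) (𝓝[>] 0) (𝓝 (m / 2)) := by
  have hD : Tendsto (fun δ => meanDistance (K δ)) (𝓝[>] 0) (𝓝 m) := by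
    have hlim : Tendsto (fun δ : ℝ => m + (n + 1) * (2 * δ)) (𝓝[>] 0) (𝓝 m) := by
      have : Continuous fun δ : ℝ => m + (n + 1) * (2 * δ) := by fun_prop
      simpa using (this.tendsto 0).mono_left nhdsWithin_le_nhds
    refine tendsto_of_tendsto_of_tendsto_of_le_of_le' tendsto_const_nhds hlim ?_ ?_
    · filter_upwards [self_mem_nhdsWithin] with δ (hδ : 0 < δ)
      rw [← hmean δ hδ]; exact ((hK δ hδ).meanDistance_bounds hδ.le).1
    · filter_upwards [self_mem_nhdsWithin] with δ (hδ : 0 < δ)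
      rw [← hmean δ hδ]; exact ((hK δ hδ).meanDistance_bounds hδ.le).2
  have hV : Tendsto (fun δ => firstIntrinsicVolume (K δ)) (𝓝[>] 0) (𝓝 2) := by
    have hlim : Tendsto (fun δ : ℝ => 2 + widthConst (n + 1) * (2 * ((n + 1) * δ)))
        (𝓝[>] 0) (𝓝 2) := by
      have : Continuous fun δ : ℝ => 2 + widthConst (n + 1) * (2 * ((n + 1) * δ)) := by fun_prop
      simpa using (this.tendsto 0).mono_left nhdsWithin_le_nhds
    refine tendsto_of_tendsto_of_tendsto_of_le_of_le' tendsto_const_nhds hlim ?_ ?_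
    · filter_upwards [self_mem_nhdsWithin] with δ (hδ : 0 < δ)
      exact ((hK δ hδ).firstIntrinsicVolume_bounds hδ.le).1
    · filter_upwards [self_mem_nhdsWithin] with δ (hδ : 0 < δ)
      exact ((hK δ hδ).firstIntrinsicVolume_bounds hδ.le).2
  exact hD.div hV two_ne_zero

lemma IsThin.image_inner_single (hK : IsThin K δ) :
    (fun x => inner ℝ (EuclideanSpace.single 0 1) x) '' K = Icc (-1 : ℝ) 1 := by
  obtain ⟨a, b, hab, hI⟩ := exists_image_inner_eq_Icc hK.isConvexBody (EuclideanSpace.single 0 1)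
  have h1 : (1 : ℝ) ∈ Icc a b := by
    rw [← hI]; exact ⟨_, hK.single_mem, by simp⟩
  have h2 : (-1 : ℝ) ∈ Icc a b := by
    rw [← hI]; exact ⟨_, hK.neg_single_mem, by simp⟩
  have h3 : ∀ s ∈ Icc a b, |s| ≤ 1 := by
    rw [← hI]; rintro _ ⟨x, hx, rfl⟩
    simpa [EuclideanSpace.inner_single_left] using hK.abs_zero_le x hx
  have h4 := abs_le.1 (h3 a (left_mem_Icc.2 hab))
  have h5 := abs_le.1 (h3 b (right_mem_Icc.2 hab))
  rw [hI, le_antisymm h2.1 h4.1, le_antisymm h5.2 h1.2]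

lemma IsThin.meanProj_eq (hK : IsThin K δ) :
    meanProj K (EuclideanSpace.single 0 1) =
      ∫ s in (-1 : ℝ)..1, 2 * (volume.real (K ∩ {x | x 0 ≤ s}) / volume.real K) *
        (1 - volume.real (K ∩ {x | x 0 ≤ s}) / volume.real K) := by
  rw [meanProj_eq_integral hK.isConvexBody _ (by norm_num) hK.image_inner_single]
  simp only [projCdf, uniformLaw_real hK.isConvexBody, EuclideanSpace.inner_single_left, map_one,
    one_mul]

end Thin

/-! ### Thin boxes -/

section Box

variable {n : ℕ} {δ : ℝ}

/-- The lower endpoints of the sides of a box `[-1, s] × [0, δ] ^ n`. -/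
def boxLower (n : ℕ) : Fin (n + 1) → ℝ := Fin.cons (-1) fun _ => 0

/-- The upper endpoints of the sides of a box `[-1, s] × [0, δ] ^ n`. -/
def boxUpper (n : ℕ) (s δ : ℝ) : Fin (n + 1) → ℝ := Fin.cons s fun _ => δ

lemma thinBox_eq (n : ℕ) (δ : ℝ) :
    thinBox (n + 1) δ = WithLp.ofLp ⁻¹' Set.pi univ fun i => Icc (boxLower n i) (boxUpper n 1 δ i) := by
  ext x
  simp only [thinBox, mem_ofPred_eq, mem_preimage, mem_univ_pi, Fin.forall_fin_succ]
  simp [boxLower, boxUpper]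

lemma volume_real_preimage_box {s : ℝ} (hs : -1 ≤ s) (hδ : 0 ≤ δ) :
    volume.real (WithLp.ofLp ⁻¹' (Set.pi univ fun i => Icc (boxLower n i) (boxUpper n s δ i)) :
      Set (EuclideanSpace ℝ (Fin (n + 1)))) = (s + 1) * δ ^ n := by
  rw [measureReal_def, (PiLp.volume_preserving_ofLp (Fin (n + 1))).measure_preimage
    (MeasurableSet.univ_pi fun i => measurableSet_Icc).nullMeasurableSet, volume_pi_pi,
    ENNReal.toReal_prod, Fin.prod_univ_succ]
  simp [boxLower, boxUpper, hδ, ENNReal.toReal_ofReal, show 0 ≤ s + 1 by linarith]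

lemma isThin_thinBox (hδ : 0 < δ) : IsThin (thinBox (n + 1) δ) δ := by
  refine ⟨⟨?_, ?_, ?_⟩, ?_, ?_, fun x hx => ?_, fun x hx i hi => ?_⟩
  · rw [thinBox_eq]
    exact (PiLp.homeomorph 2 fun _ : Fin (n + 1) => ℝ).isClosedEmbedding.isCompact_preimage
      (isCompact_univ_pi fun i => isCompact_Icc)
  · rw [thinBox_eq]
    exact (convex_pi fun i _ => convex_Icc _ _).linear_preimage
      (WithLp.linearEquiv 2 ℝ (Fin (n + 1) → ℝ)).toLinearMap
  · have hopen : IsOpen (WithLp.ofLp ⁻¹' Set.pi univ fun i => Ioo (boxLower n i) (boxUpper n 1 δ i) :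
        Set (EuclideanSpace ℝ (Fin (n + 1)))) :=
      (isOpen_set_pi finite_univ fun i _ => isOpen_Ioo).preimage (PiLp.continuous_ofLp 2 _)
    refine Set.Nonempty.mono (interior_maximal ?_ hopen) ⟨WithLp.toLp 2 (Fin.cons 0 fun _ => δ / 2), ?_⟩
    · rw [thinBox_eq]
      exact preimage_mono (pi_mono fun i _ => Ioo_subset_Icc_self)
    · simp only [mem_preimage, mem_univ_pi, Fin.forall_fin_succ]
      simp [boxLower, boxUpper, hδ]
  · intro i
    refine ⟨fun hi => ?_, fun hi => ?_⟩
    · rw [Fin.val_eq_zero_iff.1 hi]; norm_num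
    · have hi : i ≠ 0 := fun h => hi (by simp [h])
      simp [hi, hδ.le]
  · intro i
    refine ⟨fun hi => ?_, fun hi => ?_⟩
    · rw [Fin.val_eq_zero_iff.1 hi, PiLp.neg_apply, PiLp.single_apply, if_pos rfl]; norm_num
    · have hi : i ≠ 0 := fun h => hi (by simp [h])
      rw [PiLp.neg_apply, PiLp.single_apply, if_neg hi, neg_zero]
      exact ⟨le_rfl, hδ.le⟩
  · exact abs_le.2 ((hx 0).1 rfl)
  · have := (hx i).2 (Fin.val_ne_zero_iff.2 hi)
    rw [abs_of_nonneg this.1]; exact this.2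

lemma meanProj_thinBox (hδ : 0 < δ) :
    meanProj (thinBox (n + 1) δ) (EuclideanSpace.single 0 1) = 2 / 3 := by
  rw [(isThin_thinBox hδ).meanProj_eq]
  have hF : ∀ s ∈ uIcc (-1 : ℝ) 1,
      volume.real (thinBox (n + 1) δ ∩ {x | x 0 ≤ s}) / volume.real (thinBox (n + 1) δ) =
        (s + 1) / 2 := by
    intro s hs
    rw [uIcc_of_le (by norm_num)] at hs
    have h1 : thinBox (n + 1) δ ∩ {x | x 0 ≤ s} =
        WithLp.ofLp ⁻¹' Set.pi univ fun i => Icc (boxLower n i) (boxUpper n s δ i) := by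
      rw [thinBox_eq]
      ext x
      simp only [mem_inter_iff, mem_preimage, mem_univ_pi, Fin.forall_fin_succ, mem_ofPred_eq]
      simp only [boxLower, boxUpper, Fin.cons_zero, Fin.cons_succ, mem_Icc]
      constructor
      · rintro ⟨⟨h2, h3⟩, h4⟩; exact ⟨⟨h2.1, h4⟩, h3⟩
      · rintro ⟨h2, h3⟩; exact ⟨⟨⟨h2.1, h2.2.trans hs.2⟩, h3⟩, h2.2⟩
    rw [h1, thinBox_eq, volume_real_preimage_box hs.1 hδ.le,
      volume_real_preimage_box (by norm_num) hδ.le]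
    have : δ ^ n ≠ 0 := by positivity
    field_simp
    norm_num
  rw [intervalIntegral.integral_congr (g := fun s => 1 / 2 - s ^ 2 / 2) fun s hs => by
    simp only [hF s hs]; ring]
  rw [intervalIntegral.integral_sub (by simp) (Continuous.intervalIntegrable (by fun_prop) _ _)]
  simp only [intervalIntegral.integral_div, integral_pow, intervalIntegral.integral_const]
  norm_num

end Box

/-! ### Thin simplices -/

section Simplex

variable {n : ℕ} {δ : ℝ}

/-- The description of the simplex by linear inequalities. -/
lemma thinSimplex_eq (hδ : 0 < δ) :
    thinSimplex (n + 1) δ = {x | (∀ i : Fin n, 0 ≤ x i.succ) ∧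
      |x 0| + δ⁻¹ * ∑ i : Fin n, x i.succ ≤ 1} := by
  have hgen : {x : EuclideanSpace ℝ (Fin (n + 1)) | ∃ i : Fin (n + 1),
      ((i : ℕ) = 0 ∧ (x = EuclideanSpace.single i 1 ∨ x = -EuclideanSpace.single i 1)) ∨
      ((i : ℕ) ≠ 0 ∧ x = δ • EuclideanSpace.single i 1)} =
      {EuclideanSpace.single 0 1, -EuclideanSpace.single 0 1} ∪
        range fun i : Fin n => δ • EuclideanSpace.single i.succ 1 := by
    ext x
    simp only [mem_ofPred_eq, Fin.exists_fin_succ, mem_union, mem_insert_iff, mem_singleton_iff,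
      mem_range]
    simp [eq_comm]
  rw [thinSimplex, hgen]
  refine Subset.antisymm (convexHull_min ?_ ?_) ?_
  · rintro x (hx | ⟨i, rfl⟩)
    · rcases hx with rfl | rfl <;> simp
    · refine ⟨fun j => ?_, ?_⟩
      · simp only [PiLp.smul_apply, PiLp.single_apply, smul_eq_mul]
        split_ifs <;> simp [hδ.le]
      · simp [PiLp.single_apply, hδ.ne', (Fin.succ_ne_zero _).symm]
  · intro x hx y hy p q hp hq hpq
    refine ⟨fun i => ?_, ?_⟩
    · simp only [PiLp.add_apply, PiLp.smul_apply, smul_eq_mul]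
      exact add_nonneg (mul_nonneg hp (hx.1 i)) (mul_nonneg hq (hy.1 i))
    · simp only [PiLp.add_apply, PiLp.smul_apply, smul_eq_mul, Finset.sum_add_distrib,
        ← Finset.mul_sum]
      have h1 := mul_le_mul_of_nonneg_left hx.2 hp
      have h2 := mul_le_mul_of_nonneg_left hy.2 hq
      have h3 := abs_add_le (p * x 0) (q * y 0)
      rw [abs_mul, abs_mul, abs_of_nonneg hp, abs_of_nonneg hq] at h3
      nlinarith
  · rintro x ⟨hx0, hx1⟩
    -- The barycentric coordinates of `x`.
    set w := 1 - δ⁻¹ * ∑ i : Fin n, x i.succ with hw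
    have hxw := abs_le.1 (show |x 0| ≤ w by linarith)
    have hmem := subset_convexHull ℝ ({EuclideanSpace.single 0 1, -EuclideanSpace.single 0 1} ∪
        range fun i : Fin n => (δ • EuclideanSpace.single i.succ 1 :
          EuclideanSpace ℝ (Fin (n + 1))))
    let c : Bool ⊕ Fin n → ℝ := Sum.elim (fun t => if t then (w + x 0) / 2 else (w - x 0) / 2)
      fun i => δ⁻¹ * x i.succ
    let z : Bool ⊕ Fin n → EuclideanSpace ℝ (Fin (n + 1)) :=
      Sum.elim (fun t => if t then EuclideanSpace.single 0 1 else -EuclideanSpace.single 0 1)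
        fun i => δ • EuclideanSpace.single i.succ 1
    have hsum : ∑ k, c k • z k = x := by
      ext j
      simp only [c, z, Fintype.sum_sum_type, Fintype.sum_bool, Sum.elim_inl, Sum.elim_inr,
        PiLp.add_apply, WithLp.ofLp_sum, Finset.sum_apply, PiLp.smul_apply,
        PiLp.single_apply, smul_eq_mul, if_true]
      refine Fin.cases ?_ (fun j => ?_) j
      · simp [(Fin.succ_ne_zero _).symm]
        ring
      · simp [Fin.succ_ne_zero]
        field_simp
    rw [← hsum]
    refine (convex_convexHull ℝ _).sum_mem (fun k _ => ?_) ?_ fun k _ => hmem ?_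
    · rcases k with (_ | _) | i
      · simp only [c, Sum.elim_inl]; simp; linarith
      · simp only [c, Sum.elim_inl]; simp; linarith
      · exact mul_nonneg (by positivity) (hx0 i)
    · simp only [c, Fintype.sum_sum_type, Fintype.sum_bool, Sum.elim_inl, Sum.elim_inr,
        ← Finset.mul_sum]
      simp [hw]; ring
    · rcases k with (_ | _) | i
      · left; simp [z]
      · left; simp [z]
      · right; exact ⟨i, rfl⟩

lemma isThin_thinSimplex (hδ : 0 < δ) : IsThin (thinSimplex (n + 1) δ) δ := by
  have hle : ∀ x ∈ thinSimplex (n + 1) δ, |x 0| ≤ 1 ∧ ∀ i : Fin n, 0 ≤ x i.succ ∧ x i.succ ≤ δ := by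
    intro x hx
    rw [thinSimplex_eq hδ] at hx
    have h0 : 0 ≤ δ⁻¹ * ∑ i : Fin n, x i.succ :=
      mul_nonneg (by positivity) (Finset.sum_nonneg fun i _ => hx.1 i)
    refine ⟨by linarith [hx.2], fun i => ⟨hx.1 i, ?_⟩⟩
    have h1 : x i.succ ≤ ∑ i : Fin n, x i.succ :=
      Finset.single_le_sum (f := fun i : Fin n => x i.succ) (fun i _ => hx.1 i) (Finset.mem_univ i)
    have h2 : δ⁻¹ * ∑ i : Fin n, x i.succ ≤ 1 := by linarith [hx.2, abs_nonneg (x 0)]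
    rw [inv_mul_le_iff₀ hδ] at h2
    linarith
  refine ⟨⟨?_, ?_, ?_⟩, ?_, ?_, fun x hx => (hle x hx).1, fun x hx i hi => ?_⟩
  · refine Metric.isCompact_of_isClosed_isBounded ?_ ?_
    · rw [thinSimplex_eq hδ, ofPred_and]
      refine IsClosed.inter ?_ (isClosed_le (by fun_prop) continuous_const)
      simp only [ofPred_forall]
      exact isClosed_iInter fun i => isClosed_le continuous_const (by fun_prop)
    · refine (Metric.isBounded_closedBall (x := 0) (r := 1 + (n + 1) * δ)).subset fun x hx => ?_
      rw [mem_closedBall_zero_iff]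
      refine (norm_le_abs_zero_add hδ.le fun i hi => ?_).trans (add_le_add_left (hle x hx).1 _)
      obtain ⟨j, rfl⟩ := Fin.exists_succ_eq.2 hi
      have := (hle x hx).2 j
      rw [abs_of_nonneg this.1]; exact this.2
  · exact convex_convexHull ℝ _
  · have hopen : IsOpen {x : EuclideanSpace ℝ (Fin (n + 1)) | (∀ i : Fin n, 0 < x i.succ) ∧
        |x 0| + δ⁻¹ * ∑ i : Fin n, x i.succ < 1} := by
      rw [ofPred_and]
      refine IsOpen.inter ?_ (isOpen_lt (by fun_prop) continuous_const)
      simp only [ofPred_forall]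
      exact isOpen_iInter_of_finite fun i => isOpen_lt continuous_const (by fun_prop)
    refine Set.Nonempty.mono (interior_maximal ?_ hopen)
      ⟨WithLp.toLp 2 (Fin.cons 0 fun _ => δ / (n + 1)), ?_, ?_⟩
    · rw [thinSimplex_eq hδ]
      exact fun x hx => ⟨fun i => (hx.1 i).le, hx.2.le⟩
    · intro i
      simp only [Fin.cons_succ]
      positivity
    · simp only [Fin.cons_zero, Fin.cons_succ, abs_zero, zero_add, Finset.sum_const,
        Finset.card_univ, Fintype.card_fin, nsmul_eq_mul]
      rw [inv_mul_lt_iff₀ hδ, mul_one, mul_div_assoc', div_lt_iff₀ (by positivity)]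
      nlinarith
  · exact subset_convexHull ℝ _ ⟨0, .inl ⟨rfl, .inl rfl⟩⟩
  · exact subset_convexHull ℝ _ ⟨0, .inl ⟨rfl, .inr rfl⟩⟩
  · obtain ⟨j, rfl⟩ := Fin.exists_succ_eq.2 hi
    have := (hle x hx).2 j
    rw [abs_of_nonneg this.1]; exact this.2

lemma volume_hyperplane_eq_zero (c : ℝ) :
    volume {x : EuclideanSpace ℝ (Fin (n + 1)) | x 0 = c} = 0 := by
  have h0 : volume {x : EuclideanSpace ℝ (Fin (n + 1)) | x 0 = 0} = 0 := by
    have := Measure.addHaar_submodule (volume : Measure (EuclideanSpace ℝ (Fin (n + 1))))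
      (LinearMap.ker (EuclideanSpace.proj (𝕜 := ℝ) (0 : Fin (n + 1))).toLinearMap) (by
        intro h
        have h1 : EuclideanSpace.single (0 : Fin (n + 1)) (1 : ℝ) ∈
          LinearMap.ker (EuclideanSpace.proj (𝕜 := ℝ) (0 : Fin (n + 1))).toLinearMap := by
            rw [h]; trivial
        simp at h1)
    convert this using 2
    ext x
    simp
  have h1 : {x : EuclideanSpace ℝ (Fin (n + 1)) | x 0 = c} =
      (fun x => x + -(c • EuclideanSpace.single 0 1)) ⁻¹' {x | x 0 = 0} := by
    ext x
    simp [add_neg_eq_zero]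
  rw [h1, measure_preimage_add_right, h0]

/-- The half of the simplex below the level `s ≤ 0` is a homothetic copy, with centre `-e₁`, of
the half below the level `0`. -/
lemma volume_real_thinSimplex_inter (hδ : 0 < δ) {s : ℝ} (hs : -1 < s) (hs0 : s ≤ 0) :
    volume.real (thinSimplex (n + 1) δ ∩ {x | x 0 ≤ s}) =
      (1 + s) ^ (n + 1) * volume.real (thinSimplex (n + 1) δ ∩ {x | x 0 ≤ 0}) := by
  have hr : 0 < 1 + s := by linarith
  have hA : ∀ t ≤ 0, thinSimplex (n + 1) δ ∩ {x | x 0 ≤ t} = {x | (∀ i : Fin n, 0 ≤ x i.succ) ∧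
      -x 0 + δ⁻¹ * ∑ i : Fin n, x i.succ ≤ 1 ∧ x 0 ≤ t} := by
    intro t ht
    rw [thinSimplex_eq hδ]
    ext x
    simp only [mem_inter_iff, mem_ofPred_eq, and_assoc]
    refine and_congr_right fun _ => and_congr_left fun hx => ?_
    rw [abs_of_nonpos (hx.trans ht)]
  set φ := AffineMap.homothety (-EuclideanSpace.single 0 1 : EuclideanSpace ℝ (Fin (n + 1))) (1 + s)
    with hφ
  have hφ0 : ∀ x, φ x 0 = (1 + s) * (x 0 + 1) - 1 := by
    intro x; simp [hφ, AffineMap.homothety_apply]; ring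
  have hφs : ∀ x (i : Fin n), φ x i.succ = (1 + s) * x i.succ := by
    intro x i; simp [hφ, AffineMap.homothety_apply]; ring
  have himage : thinSimplex (n + 1) δ ∩ {x | x 0 ≤ s} =
      φ '' (thinSimplex (n + 1) δ ∩ {x | x 0 ≤ 0}) := by
    have hiff : ∀ x, φ x ∈ thinSimplex (n + 1) δ ∩ {x | x 0 ≤ s} ↔
        x ∈ thinSimplex (n + 1) δ ∩ {x | x 0 ≤ 0} := by
      intro x
      rw [hA s hs0, hA 0 le_rfl]
      simp only [mem_ofPred_eq, hφ0, hφs, ← Finset.mul_sum]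
      refine and_congr (forall_congr' fun i => mul_nonneg_iff_of_pos_left hr) (and_congr ?_ ?_)
      · constructor <;> intro h
        · nlinarith
        · nlinarith
      · constructor <;> intro h
        · nlinarith
        · nlinarith
    ext y
    constructor
    · intro hy
      have hyx : φ (AffineMap.homothety (-EuclideanSpace.single 0 1) (1 + s)⁻¹ y) = y := by
        rw [hφ, ← AffineMap.homothety_mul_apply, mul_inv_cancel₀ hr.ne', AffineMap.homothety_one]
        rfl
      rw [← hyx, hiff] at hy
      exact ⟨_, hy, hyx⟩
    · rintro ⟨x, hx, rfl⟩
      exact (hiff x).2 hx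
  rw [himage, measureReal_def, hφ, Measure.addHaar_image_homothety, ENNReal.toReal_mul,
    ENNReal.toReal_ofReal (abs_nonneg _), finrank_euclideanSpace_fin, abs_of_pos (by positivity),
    measureReal_def]

/-- The simplex is symmetric with respect to the hyperplane orthogonal to `e₁`. -/
lemma volume_real_thinSimplex_symm (hδ : 0 < δ) (s : ℝ) :
    volume.real (thinSimplex (n + 1) δ ∩ {x | x 0 ≤ s}) +
      volume.real (thinSimplex (n + 1) δ ∩ {x | x 0 ≤ -s}) =
      volume.real (thinSimplex (n + 1) δ) := by
  have hT := (isThin_thinSimplex (n := n) hδ).isConvexBody.isCompact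
  let ρ : EuclideanSpace ℝ (Fin (n + 1)) ≃ₗᵢ[ℝ] EuclideanSpace ℝ (Fin (n + 1)) :=
    LinearIsometryEquiv.piLpCongrRight 2 fun i =>
      if i = 0 then LinearIsometryEquiv.neg ℝ else LinearIsometryEquiv.refl ℝ ℝ
  have hρ0 : ∀ x, ρ x 0 = -x 0 := fun x => by simp [ρ]
  have hρs : ∀ x (i : Fin n), ρ x i.succ = x i.succ := fun x i => by simp [ρ]
  have hpre : ρ ⁻¹' (thinSimplex (n + 1) δ ∩ {x | s < x 0}) =
      thinSimplex (n + 1) δ ∩ {x | x 0 < -s} := by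
    rw [thinSimplex_eq hδ]
    ext x
    simp only [mem_preimage, mem_inter_iff, mem_ofPred_eq, hρ0, hρs, abs_neg, lt_neg]
  have hm : MeasurableSet {x : EuclideanSpace ℝ (Fin (n + 1)) | x 0 ≤ s} :=
    measurableSet_le (by fun_prop) measurable_const
  have h1 := measureReal_inter_add_sdiff (μ := volume) (s := thinSimplex (n + 1) δ) hm
    hT.measure_lt_top.ne
  have h2 : thinSimplex (n + 1) δ \ {x | x 0 ≤ s} = thinSimplex (n + 1) δ ∩ {x | s < x 0} := by
    ext x; simp
  have h3 : volume.real (thinSimplex (n + 1) δ ∩ {x | s < x 0}) =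
      volume.real (thinSimplex (n + 1) δ ∩ {x | x 0 ≤ -s}) := by
    rw [measureReal_def, ← ρ.measurePreserving.measure_preimage_emb
      ρ.toMeasurableEquiv.measurableEmbedding, hpre, measureReal_def]
    congr 1
    refine measure_congr ((ae_eq_refl _).inter ?_)
    have hne : ∀ᵐ x : EuclideanSpace ℝ (Fin (n + 1)), x 0 ≠ -s := by
      rw [ae_iff]; simpa using volume_hyperplane_eq_zero (n := n) (-s)
    filter_upwards [hne] with x hx
    exact propext ⟨le_of_lt, fun h => lt_of_le_of_ne h hx⟩
  rw [h2, h3] at h1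
  exact h1

/-- The distribution function of the first coordinate is `(1 + s) ^ d / 2` on `[-1, 0]`, which is
the case of equality in the lower bound. -/
lemma meanProj_thinSimplex (hδ : 0 < δ) :
    meanProj (thinSimplex (n + 1) δ) (EuclideanSpace.single 0 1) = 2 * lowerConst (n + 1) := by
  have hthin := isThin_thinSimplex (n := n) hδ
  have hV := hthin.isConvexBody.volume_real_pos
  rw [hthin.meanProj_eq]
  set F : ℝ → ℝ := fun s => volume.real (thinSimplex (n + 1) δ ∩ {x | x 0 ≤ s}) /
    volume.real (thinSimplex (n + 1) δ) with hF
  have hsymm : ∀ s, F s = 1 - F (-s) := by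
    intro s
    rw [eq_sub_iff_add_eq, hF, ← add_div, volume_real_thinSimplex_symm hδ, div_self hV.ne']
  have hF0 : F 0 = 1 / 2 := by
    have := hsymm 0
    rw [neg_zero] at this
    linarith
  have hneg : ∀ s, -1 < s → s ≤ 0 → F s = (1 + s) ^ (n + 1) / 2 := by
    intro s hs hs0
    have h : F s = (1 + s) ^ (n + 1) * F 0 := by
      simp only [hF]
      rw [volume_real_thinSimplex_inter hδ hs hs0, mul_div_assoc]
    rw [h, hF0]; ring
  -- The integrand on `[0, 1]`; it is an even function.
  have hpos : ∀ s, 0 ≤ s → s < 1 → 2 * F s * (1 - F s) =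
      (1 - s) ^ (n + 1) - (1 - s) ^ (2 * n + 2) / 2 := by
    intro s hs0 hs
    rw [hsymm s, hneg (-s) (by linarith) (by linarith)]
    ring
  have hsub : ∀ k : ℕ, ∫ s in (0 : ℝ)..1, (1 - s) ^ k = 1 / ((k : ℝ) + 1) := by
    intro k
    rw [intervalIntegral.integral_comp_sub_left (fun x => x ^ k) 1]
    simp
  have hright : ∫ s in (0 : ℝ)..1, 2 * F s * (1 - F s) = lowerConst (n + 1) := by
    have hae : ∀ᵐ s : ℝ, s ∈ uIoc 0 1 → 2 * F s * (1 - F s) =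
        (1 - s) ^ (n + 1) - (1 - s) ^ (2 * n + 2) / 2 := by
      have hne : ∀ᵐ s : ℝ, s ≠ 1 := by rw [ae_iff]; simp
      filter_upwards [hne] with s hs1 hs
      rw [uIoc_of_le zero_le_one] at hs
      exact hpos s hs.1.le (lt_of_le_of_ne hs.2 hs1)
    rw [intervalIntegral.integral_congr_ae hae, intervalIntegral.integral_sub
      (Continuous.intervalIntegrable (by fun_prop) _ _)
      (Continuous.intervalIntegrable (by fun_prop) _ _), intervalIntegral.integral_div, hsub, hsub,
      lowerConst]
    push_cast
    field_simp
    ring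
  have hint : ∀ a b : ℝ, IntervalIntegrable (fun s => 2 * F s * (1 - F s)) volume a b := by
    intro a b
    have hmono : Monotone F := fun s t hst => by
      refine div_le_div_of_nonneg_right (measureReal_mono
        (inter_subset_inter_right _ fun x (hx : x 0 ≤ s) => hx.trans hst) ?_) hV.le
      exact ne_top_of_le_ne_top hthin.isConvexBody.isCompact.measure_lt_top.ne
        (measure_mono inter_subset_left)
    have hF1 : ∀ s, F s ≤ 1 := fun s => (div_le_one hV).2 (measureReal_mono inter_subset_left
      hthin.isConvexBody.isCompact.measure_lt_top.ne)
    have hbound : ∀ s, ‖2 * F s * (1 - F s)‖ ≤ 2 := fun s => by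
      have h0 : 0 ≤ F s := div_nonneg measureReal_nonneg hV.le
      rw [Real.norm_eq_abs, abs_le]
      constructor <;> nlinarith [hF1 s, mul_nonneg h0 (sub_nonneg.2 (hF1 s))]
    exact (intervalIntegrable_const (c := (2 : ℝ))).mono_fun'
      ((hmono.measurable.const_mul 2).mul (hmono.measurable.const_sub 1)).aestronglyMeasurable
      (ae_of_all _ hbound)
  have hleft : ∫ s in (-1 : ℝ)..0, 2 * F s * (1 - F s) = lowerConst (n + 1) := by
    rw [← hright]
    have := intervalIntegral.integral_comp_neg (a := 0) (b := 1) (fun s => 2 * F s * (1 - F s))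
    rw [neg_zero] at this
    rw [← this]
    refine intervalIntegral.integral_congr fun s _ => ?_
    simp only [hsymm s]
    ring
  have hadd := intervalIntegral.integral_add_adjacent_intervals (hint (-1) 0) (hint 0 1)
  rw [hleft, hright] at hadd
  linarith

end Simplex

end MeanDistance

theorem theorem1 (d : ℕ) (hd : 2 ≤ d) :
    (∀ K : Set (EuclideanSpace ℝ (Fin d)), MeanDistance.IsConvexBody K →
      (3 * (d : ℝ) + 1) / (2 * ((d : ℝ) + 1) * (2 * (d : ℝ) + 1)) <
          MeanDistance.meanDistance K / MeanDistance.firstIntrinsicVolume K ∧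
        MeanDistance.meanDistance K / MeanDistance.firstIntrinsicVolume K < 1 / 3) ∧
    (∀ δ : ℝ, 0 < δ →
      MeanDistance.IsConvexBody (MeanDistance.thinSimplex d δ) ∧
        MeanDistance.IsConvexBody (MeanDistance.thinBox d δ)) ∧
    Tendsto
      (fun δ : ℝ => MeanDistance.meanDistance (MeanDistance.thinSimplex d δ) /
        MeanDistance.firstIntrinsicVolume (MeanDistance.thinSimplex d δ))
      (𝓝[>] 0) (𝓝 ((3 * (d : ℝ) + 1) / (2 * ((d : ℝ) + 1) * (2 * (d : ℝ) + 1)))) ∧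
    Tendsto
      (fun δ : ℝ => MeanDistance.meanDistance (MeanDistance.thinBox d δ) /
        MeanDistance.firstIntrinsicVolume (MeanDistance.thinBox d δ))
      (𝓝[>] 0) (𝓝 (1 / 3)) := by
  obtain ⟨n, rfl⟩ : ∃ n, d = n + 1 := ⟨d - 1, by omega⟩
  have hn : n ≠ 0 := by omega
  refine ⟨fun K hK => MeanDistance.ratio_bounds hn hK, fun δ hδ =>
    ⟨(MeanDistance.isThin_thinSimplex hδ).isConvexBody,
      (MeanDistance.isThin_thinBox hδ).isConvexBody⟩, ?_, ?_⟩
  · have h := MeanDistance.tendsto_ratio_of_isThin (n := n)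
      (fun δ hδ => MeanDistance.isThin_thinSimplex hδ)
      fun δ hδ => MeanDistance.meanProj_thinSimplex hδ
    rwa [mul_div_cancel_left₀ _ two_ne_zero] at h
  · have h := MeanDistance.tendsto_ratio_of_isThin (n := n)
      (fun δ hδ => MeanDistance.isThin_thinBox hδ)
      fun δ hδ => MeanDistance.meanProj_thinBox hδ
    rwa [show (2 / 3 : ℝ) / 2 = 1 / 3 by norm_num] at h
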